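/- Let $\Bbbk$ be an algebraically closed field of characteristic $0$, and let $C$ be a premodular category over $\Bbbk$, i.e. a braided fusion category over $\Bbbk$ (a rigid braided monoidal finite semisimple $\Bbbk$-linear abelian category with $\Bbbk$-bilinear tensor product and $\operatorname{End}_C(\mathbb 1)\cong\Bbbk$) equipped with a ribbon structure. Write $c_{A,B}\colon A\otimes B\to B\otimes A$ for the braiding, and suppress associativity isomorphisms. Let $n\ge 0$ and let $\sigma$ be an admissible gluing of rank $n$, i.e. a permutation of $\{1,\dots,2n\}$ with $\sigma^2=1$ and without fixed points. For $i\in\{1,\dots,2n\}$ let $[i]=\{i,\sigma(i)\}$ be its orbit, and let $[i]'<[i]''$ be the two elements of $[i]$. The category $Z_\sigma(C)$ is defined as follows. An object is a pair $(X,\gamma)$ of an object $X$ of $C$ and a family $\gamma=(\gamma_{[i]})$, indexed by the $n$ orbits of $\sigma$, of half-braidings $\gamma_{[i],Z}\colon Z\otimes X\xrightarrow{\ \sim\ }X\otimes Z$ (isomorphisms natural in $Z\in C$ with $\gamma_{[i],Z\otimes W}=(\gamma_{[i],Z}\otimes 1)(1\otimes\gamma_{[i],W})$), such that for all $i,j\in\{1,\dots,2n\}$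 and all objects $Z_1,Z_2$ of $C$ the following hold: 1. if $[i]'<[i]''<[j]'<[j]''$, then, with $\tilde\gamma_{[i],Z_1}=c_{Z_1,X}\,c_{X,Z_1}\,\gamma_{[i],Z_1}$, $$(\gamma_{[j],Z_2}\otimes 1)(1\otimes\tilde\gamma_{[i],Z_1})=(1\otimes c_{Z_1,Z_2})(\tilde\gamma_{[i],Z_1}\otimes 1)(1\otimes\gamma_{[j],Z_2})(c_{Z_1,Z_2}^{-1}\otimes 1);$$ 2. if $[i]'<[j]'<[i]''<[j]''$, then $$(\gamma_{[j],Z_2}\otimes 1)(1\otimes\gamma_{[i],Z_1})=(1\otimes c_{Z_2,Z_1}^{-1})(\gamma_{[i],Z_1}\otimes 1)(1\otimes\gamma_{[j],Z_2})(c_{Z_1,Z_2}^{-1}\otimes 1);$$ 3. if $[i]'<[j]'<[j]''<[i]''$, then $$(\gamma_{[j],Z_2}\otimes 1)(1\otimes\gamma_{[i],Z_1})=(1\otimes c_{Z_1,Z_2})(\gamma_{[i],Z_1}\otimes 1)(1\otimes\gamma_{[j],Z_2})(c_{Z_1,Z_2}^{-1}\otimes 1).$$ A morphism $(X,\gamma)\to(Y,\beta)$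 is a morphism $f\colon X\to Y$ of $C$ such that $\beta_{[i],Z}(1_Z\otimes f)=(f\otimes 1_Z)\gamma_{[i],Z}$ for all $i$ and all $Z\in C$; identities, composition and the $\Bbbk$-linear structure are those of $C$. Then $Z_\sigma(C)$ is a finite semisimple abelian category over $\Bbbk$: it is a $\Bbbk$-linear abelian category with finite-dimensional Hom spaces in which every object has finite length, every simple object has a projective cover, there are only finitely many isomorphism classes of simple objects, and every object is a direct sum of simple objects. -/

import Mathlib

open CategoryTheory CategoryTheory.Limits MonoidalCategory

universe w v u

/-! ### Finite semisimple abelian categories over a field -/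

section LinearCategories

variable (C : Type u) [Category.{v} C]

/-- The given preadditive structure makes `C` an abelian category: there are a null object and
biproducts, kernels and cokernels, every mono is a kernel and every epi is a cokernel. -/
structure IsAbelianCategory [Preadditive C] : Prop where
  hasFiniteProducts : HasFiniteProducts C
  hasKernels : HasKernels C
  hasCokernels : HasCokernels C
  normalMono : IsNormalMonoCategory C
  normalEpi : IsNormalEpiCategory C

variable {C}

/-- Objects with a finite filtration `0 = X₀ ⟶ X₁ ⟶ ⋯ ⟶ Xₙ` by monomorphisms all of whose
successive quotients are simple. -/
inductive HasFiniteLength [HasZeroMorphisms C] : C → Prop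
  | zero {X : C} (h : IsZero X) : HasFiniteLength X
  | extend (S : ShortComplex C) (hS : S.ShortExact) (h₁ : HasFiniteLength S.X₁)
      (h₃ : Simple S.X₃) : HasFiniteLength S.X₂

/-- `X` is a direct sum of simple objects. The sum is finite; this is no restriction where all
objects have finite length, as is the case in every category considered below. -/
def IsSemisimpleObject [HasZeroMorphisms C] (X : C) : Prop :=
  ∃ (m : ℕ) (S : Fin m → C) (b : Bicone S),
    (∀ i, Simple (S i)) ∧ Nonempty b.IsBilimit ∧ Nonempty (b.pt ≅ X)

/-- `p : P ⟶ X` is a projective cover of `X`. -/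
structure IsProjectiveCover {P X : C} (p : P ⟶ X) : Prop where
  projective : Projective P
  epi : Epi p
  minimal : ∀ {Q : C} (g : Q ⟶ X), Projective Q → Epi g → ∃ h : Q ⟶ P, Epi h ∧ h ≫ p = g

variable (k : Type w) [Field k] (C)

/-- The `k`-linear category `C` is a finite abelian category over `k`. -/
structure IsFiniteAbelian [Preadditive C] [Linear k C] : Prop where
  isAbelian : IsAbelianCategory C
  hasFiniteLength : ∀ X : C, HasFiniteLength X
  finiteDimensional_hom : ∀ X Y : C, FiniteDimensional k (X ⟶ Y)
  exists_projectiveCover : ∀ X : C, Simple X → ∃ (P : C) (p : P ⟶ X), IsProjectiveCover p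
  finite_simples : {c : Quotient (isIsomorphicSetoid C) |
    ∃ X : C, Simple X ∧ Quotient.mk (isIsomorphicSetoid C) X = c}.Finite

/-- The `k`-linear category `C` is a finite semisimple abelian category over `k`. -/
structure IsFiniteSemisimpleAbelian [Preadditive C] [Linear k C] : Prop
    extends IsFiniteAbelian C k where
  isSemisimple : ∀ X : C, IsSemisimpleObject X

end LinearCategories

/-! ### Premodular categories -/

section Premodular

/-- A ribbon structure: a twist `θ`, i.e. an automorphism of the identity functor with
`θ_{X ⊗ Y} = (θ_X ⊗ θ_Y) ∘ c_{Y,X} ∘ c_{X,Y}`, such that `(θ_X)^* = θ_{X^*}`. -/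
structure RibbonStructure (C : Type u) [Category.{v} C] [MonoidalCategory C] [BraidedCategory C]
    [RigidCategory C] where
  twist : 𝟭 C ≅ 𝟭 C
  twist_tensor : ∀ X Y : C, twist.hom.app (X ⊗ Y) =
    (β_ X Y).hom ≫ (β_ Y X).hom ≫ (twist.hom.app X ⊗ₘ twist.hom.app Y)
  twist_dual : ∀ X : C, rightAdjointMate (twist.hom.app X) = twist.hom.app (Xᘁ)

/-- A premodular category over `k`: a ribbon fusion category, that is, a braided rigid monoidal
`k`-linear category with `k`-bilinear tensor product which is finite semisimple abelian, has
`End 𝟙 ≅ k`, and is equipped with a ribbon structure. -/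
class PremodularCategory (k : Type w) [Field k] (C : Type u) [Category.{v} C] [Preadditive C]
    [Linear k C] [MonoidalCategory C] [MonoidalPreadditive C] [MonoidalLinear k C]
    [BraidedCategory C] [RigidCategory C] where
  isFiniteSemisimpleAbelian : IsFiniteSemisimpleAbelian C k
  end_unit : Nonempty (End (𝟙_ C) ≃ₐ[k] k)
  ribbon : RibbonStructure C

end Premodular

/-! ### Admissible gluings -/

/-- Admissible gluings of rank `n`: fixed-point-free involutions of a linearly ordered set with
`2n` elements. -/
def AdmissibleGluing (n : ℕ) : Type :=
  {σ : Equiv.Perm (Fin (2 * n)) // (∀ i, σ i ≠ i) ∧ σ * σ = 1}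

namespace AdmissibleGluing

variable {n : ℕ} (σ : AdmissibleGluing n)

/-- The set of orbits of `σ`. -/
def Orbit : Type := Quotient (Equiv.Perm.SameCycle.setoid σ.1)

/-- The orbit `[i] = {i, σ i}`. -/
def orbit (i : Fin (2 * n)) : σ.Orbit := Quotient.mk (Equiv.Perm.SameCycle.setoid σ.1) i

/-- The smaller element `[i]'` of `[i]`. -/
def lower (i : Fin (2 * n)) : Fin (2 * n) := min i (σ.1 i)

/-- The larger element `[i]''` of `[i]`. -/
def upper (i : Fin (2 * n)) : Fin (2 * n) := max i (σ.1 i)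

end AdmissibleGluing

/-! ### The categorical center of higher genera -/

section HigherCenter

variable {C : Type u} [Category.{v} C] [MonoidalCategory C]

/-- The half-braiding `γ` read as a natural isomorphism `γ_Z : Z ⊗ X ⟶ X ⊗ Z`. (In Mathlib's
convention a half-braiding of `X` consists of isomorphisms `X ⊗ Z ≅ Z ⊗ X`; we take inverses.) -/
def CategoryTheory.HalfBraiding.cross {X : C} (γ : HalfBraiding X) (Z : C) : Z ⊗ X ⟶ X ⊗ Z :=
  (γ.β Z).inv

variable [BraidedCategory C]

/-- For `a : Z₁ ⊗ X ⟶ X ⊗ Z₁`, `b : Z₂ ⊗ X ⟶ X ⊗ Z₂` and `d : Z₁ ⊗ Z₂ ⟶ Z₂ ⊗ Z₁`, the equation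
`(b ⊗ 1) ∘ (1 ⊗ a) = (1 ⊗ d) ∘ (a ⊗ 1) ∘ (1 ⊗ b) ∘ (c_{Z₁,Z₂}⁻¹ ⊗ 1)`
of morphisms `Z₂ ⊗ Z₁ ⊗ X ⟶ X ⊗ Z₂ ⊗ Z₁`. -/
def ExchangeRelation {X Z₁ Z₂ : C} (a : Z₁ ⊗ X ⟶ X ⊗ Z₁) (b : Z₂ ⊗ X ⟶ X ⊗ Z₂)
    (d : Z₁ ⊗ Z₂ ⟶ Z₂ ⊗ Z₁) : Prop :=
  Z₂ ◁ a ≫ (α_ Z₂ X Z₁).inv ≫ b ▷ Z₁ =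
    (α_ Z₂ Z₁ X).inv ≫ (β_ Z₁ Z₂).inv ▷ X ≫ (α_ Z₁ Z₂ X).hom ≫ Z₁ ◁ b ≫
      (α_ Z₁ X Z₂).inv ≫ a ▷ Z₂ ≫ (α_ X Z₁ Z₂).hom ≫ X ◁ d ≫ (α_ X Z₂ Z₁).inv

/-- The relation for `[i]' < [i]'' < [j]' < [j]''`, with `γ = γ_[i]` and `δ = γ_[j]`; here `γ` enters
through `c_{Z₁,X} ∘ c_{X,Z₁} ∘ γ_{Z₁}`. -/
def Comm1 {X : C} (γ δ : HalfBraiding X) : Prop :=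
  ∀ Z₁ Z₂ : C, ExchangeRelation (γ.cross Z₁ ≫ (β_ X Z₁).hom ≫ (β_ Z₁ X).hom) (δ.cross Z₂)
    (β_ Z₁ Z₂).hom

/-- The relation for `[i]' < [j]' < [i]'' < [j]''`, with `γ = γ_[i]` and `δ = γ_[j]`. -/
def Comm2 {X : C} (γ δ : HalfBraiding X) : Prop :=
  ∀ Z₁ Z₂ : C, ExchangeRelation (γ.cross Z₁) (δ.cross Z₂) (β_ Z₂ Z₁).inv

/-- The relation for `[i]' < [j]' < [j]'' < [i]''`, with `γ = γ_[i]` and `δ = γ_[j]`. -/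
def Comm3 {X : C} (γ δ : HalfBraiding X) : Prop :=
  ∀ Z₁ Z₂ : C, ExchangeRelation (γ.cross Z₁) (δ.cross Z₂) (β_ Z₁ Z₂).hom

variable (C) in
/-- The objects of the categorical center of higher genera `Z_σ(C)`: the `σ`-pairs of `C`. -/
structure HigherCenter {n : ℕ} (σ : AdmissibleGluing n) where
  X : C
  γ : σ.Orbit → HalfBraiding X
  comm1 : ∀ i j, σ.lower i < σ.upper i → σ.upper i < σ.lower j → σ.lower j < σ.upper j →
    Comm1 (γ (σ.orbit i)) (γ (σ.orbit j))
  comm2 : ∀ i j, σ.lower i < σ.lower j → σ.lower j < σ.upper i → σ.upper i < σ.upper j →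
    Comm2 (γ (σ.orbit i)) (γ (σ.orbit j))
  comm3 : ∀ i j, σ.lower i < σ.lower j → σ.lower j < σ.upper j → σ.upper j < σ.upper i →
    Comm3 (γ (σ.orbit i)) (γ (σ.orbit j))

namespace HigherCenter

variable {n : ℕ} {σ : AdmissibleGluing n}

/-- A `σ`-morphism: a morphism of `C` compatible with all the half-braidings. -/
@[ext]
structure Hom (A B : HigherCenter C σ) where
  f : A.X ⟶ B.X
  comm : ∀ (o : σ.Orbit) (Z : C), Z ◁ f ≫ (B.γ o).cross Z = (A.γ o).cross Z ≫ f ▷ Z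

instance : Category.{v} (HigherCenter C σ) where
  Hom := Hom
  id A := { f := 𝟙 A.X, comm := by simp }
  comp p q :=
    { f := p.f ≫ q.f
      comm := fun o Z => by
        rw [MonoidalCategory.whiskerLeft_comp, Category.assoc, q.comm, ← Category.assoc, p.comm,
          Category.assoc, MonoidalCategory.comp_whiskerRight] }

@[ext]
theorem hom_ext {A B : HigherCenter C σ} (p q : A ⟶ B) (h : p.f = q.f) : p = q :=
  Hom.ext h

@[simp]
theorem id_f (A : HigherCenter C σ) : Hom.f (𝟙 A) = 𝟙 A.X := rfl

@[simp]
theorem comp_f {A B D : HigherCenter C σ} (p : A ⟶ B) (q : B ⟶ D) : (p ≫ q).f = p.f ≫ q.f := rfl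

section Additive

variable [Preadditive C] [MonoidalPreadditive C]

instance (A B : HigherCenter C σ) : Zero (A ⟶ B) := ⟨⟨0, fun o Z => by simp⟩⟩

instance (A B : HigherCenter C σ) : Add (A ⟶ B) :=
  ⟨fun p q => ⟨p.f + q.f, fun o Z => by
    simp [MonoidalPreadditive.whiskerLeft_add, MonoidalPreadditive.add_whiskerRight, p.comm,
      q.comm]⟩⟩

instance (A B : HigherCenter C σ) : Neg (A ⟶ B) :=
  ⟨fun p => ⟨-p.f, fun o Z => by
    have h₁ : Z ◁ (-p.f) = -(Z ◁ p.f) :=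
      eq_neg_of_add_eq_zero_left (by rw [← MonoidalPreadditive.whiskerLeft_add]; simp)
    have h₂ : (-p.f) ▷ Z = -(p.f ▷ Z) :=
      eq_neg_of_add_eq_zero_left (by rw [← MonoidalPreadditive.add_whiskerRight]; simp)
    rw [h₁, h₂, Preadditive.neg_comp, Preadditive.comp_neg, p.comm]⟩⟩

@[simp]
theorem zero_f (A B : HigherCenter C σ) : (0 : A ⟶ B).f = 0 := rfl

@[simp]
theorem add_f {A B : HigherCenter C σ} (p q : A ⟶ B) : (p + q).f = p.f + q.f := rfl

@[simp]
theorem neg_f {A B : HigherCenter C σ} (p : A ⟶ B) : (-p).f = -p.f := rfl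

instance (A B : HigherCenter C σ) : AddCommGroup (A ⟶ B) where
  add_assoc p q r := by ext; simp [add_assoc]
  zero_add p := by ext; simp
  add_zero p := by ext; simp
  add_comm p q := by ext; simp [add_comm]
  neg_add_cancel p := by ext; simp
  nsmul := nsmulRec
  zsmul := zsmulRec

instance : Preadditive (HigherCenter C σ) where
  add_comp _ _ _ p q r := by ext; simp
  comp_add _ _ _ p q r := by ext; simp

variable {k : Type w} [Field k] [Linear k C] [MonoidalLinear k C]

instance (A B : HigherCenter C σ) : SMul k (A ⟶ B) :=
  ⟨fun t p => ⟨t • p.f, fun o Z => by simp [p.comm]⟩⟩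

@[simp]
theorem smul_f {A B : HigherCenter C σ} (t : k) (p : A ⟶ B) : (t • p).f = t • p.f := rfl

instance (A B : HigherCenter C σ) : Module k (A ⟶ B) where
  one_smul p := by ext; simp
  mul_smul s t p := by ext; simp [mul_smul]
  smul_zero t := by ext; simp
  smul_add t p q := by ext; simp
  add_smul s t p := by ext; simp [add_smul]
  zero_smul p := by ext; simp

instance : Linear k (HigherCenter C σ) where
  smul_comp _ _ _ t p q := by ext; simp
  comp_smul _ _ _ p t q := by ext; simp

end Additive

end HigherCenter

end HigherCenter

/-! ### Direct sum decompositions in preadditive categories -/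

/-! The argument is Maschke's: projections of `C` are averaged into morphisms of `Z_σ(C)`.

Call a category regular if every morphism `f` has a `g` with `f ≫ g ≫ f = f`. Semisimplicity makes
`C` regular. Conversely, a regular preadditive category with split idempotents and finite products
is abelian with all objects projective, and finite-dimensional endomorphism algebras force every
object to be a finite sum of simples. Idempotents and finite products lift from `C` to `Z_σ(C)` by
gluing half-braidings, so only regularity and the finiteness of the set of simples need the
averaging.

For one half-braiding, let `a i` represent the simples and let `d i` be their dimensions. Send `f :
X ⟶ Y` to `(∑ d i ^ 2)⁻¹ ∑ d i • ptr`, where `ptr` is the partial trace over `a i` of the conjugate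
of `f` by the half-braidings with `a i`. The result is compatible with the half-braidings because
the weighted sum of loops absorbs any object (`sum_ptr_tensor_eq_sum_ptr_whiskerRight`). Identities
are fixed, since the loop over `a i` contributes `d i`. The division is legitimate because the
global dimension is nonzero in characteristic `0` (`sum_dim_sq_ne_zero`).

For several orbits, the averages are composed in increasing order of lower elements. The relations
in the definition of `Z_σ(C)` are exactly what moves a strand crossing by an earlier half-braiding
through the loop of the new one, so a new average preserves the compatibilities already achieved
(`isCompatible_ptr_conj`). The total average commutes with composition by morphisms of `Z_σ(C)` on
either side, so averaging `g` gives a generalized inverse in `Z_σ(C)`.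

The average is recorded as a sum `unit ≫ F_s(f) ≫ counit` with finitely many functors `F_s`
independent of the objects. This bounds the number of simples: those detected by a fixed `a i` give
linearly independent vectors in the finite-dimensional space `∏ s, (a i ⟶ F_s (a i))`. -/

section Decompositions

variable {C : Type u} [Category.{v} C]

/-- Every morphism has a generalized inverse. -/
def IsRegularCategory (C : Type u) [Category.{v} C] : Prop :=
  ∀ {X Y : C} (f : X ⟶ Y), ∃ g : Y ⟶ X, f ≫ g ≫ f = f

theorem IsRegularCategory.exists_retraction (hC : IsRegularCategory C) {X Y : C}
    (f : X ⟶ Y) [Mono f] :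
    ∃ r, f ≫ r = 𝟙 X := by
  obtain ⟨g, hg⟩ := hC f
  exact ⟨g, by rw [← cancel_mono f]; simpa using hg⟩

theorem IsRegularCategory.exists_section (hC : IsRegularCategory C) {X Y : C}
    (f : X ⟶ Y) [Epi f] :
    ∃ r, r ≫ f = 𝟙 Y := by
  obtain ⟨g, hg⟩ := hC f
  exact ⟨g, by rw [← cancel_epi f]; simpa using hg⟩

theorem IsRegularCategory.projective (hC : IsRegularCategory C) (P : C) : Projective P where
  factors f e _ := by
    obtain ⟨r, hr⟩ := hC.exists_section e
    exact ⟨f ≫ r, by simp [hr]⟩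

variable [Preadditive C]

/-- Inclusions and projections exhibiting `X` as the direct sum of the finite family `S`. -/
structure SumDecomposition {J : Type*} [Fintype J] (S : J → C) (X : C) where
  ι : ∀ j, S j ⟶ X
  π : ∀ j, X ⟶ S j
  ι_π_self : ∀ j, ι j ≫ π j = 𝟙 (S j)
  ι_π_ne : ∀ {j j'}, j ≠ j' → ι j ≫ π j' = 0
  total : ∑ j, π j ≫ ι j = 𝟙 X

namespace SumDecomposition

variable {J : Type*} [Fintype J] {S : J → C} {X : C}

/-- The bicone of a direct sum decomposition. -/
def bicone (d : SumDecomposition S X) : Bicone S where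
  pt := X
  ι := d.ι
  π := d.π
  ι_π j j' := by
    split_ifs with h
    · subst h; simpa using d.ι_π_self j
    · exact d.ι_π_ne h

theorem isBilimit (d : SumDecomposition S X) : Nonempty d.bicone.IsBilimit :=
  ⟨isBilimitOfTotal _ d.total⟩

/-- The decomposition given by a bilimit bicone. -/
def ofIsBilimit {b : Bicone S} (hb : b.IsBilimit) (e : b.pt ≅ X) : SumDecomposition S X where
  ι j := b.ι j ≫ e.hom
  π j := e.inv ≫ b.π j
  ι_π_self j := by simp
  ι_π_ne h := by simp [bicone_ι_π_ne b h]
  total := by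
    have := IsBilimit.total hb
    simp only [Category.assoc]
    rw [← Preadditive.comp_sum]
    simp only [← Category.assoc]
    rw [← Preadditive.sum_comp, this]
    simp

/-- Change the summands of a decomposition along isomorphisms. -/
def congr {T : J → C} (d : SumDecomposition S X) (e : ∀ j, S j ≅ T j) : SumDecomposition T X where
  ι j := (e j).inv ≫ d.ι j
  π j := d.π j ≫ (e j).hom
  ι_π_self j := by simp [reassoc_of% d.ι_π_self j]
  ι_π_ne h := by simp [reassoc_of% d.ι_π_ne h]
  total := by simpa using d.total

/-- Reindex a decomposition. -/
def reindex {J' : Type*} [Fintype J'] (d : SumDecomposition S X) (e : J' ≃ J) :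
    SumDecomposition (S ∘ e) X where
  ι j := d.ι (e j)
  π j := d.π (e j)
  ι_π_self j := d.ι_π_self _
  ι_π_ne h := d.ι_π_ne (e.injective.ne h)
  total := by rw [← d.total]; exact e.sum_comp fun j => d.π j ≫ d.ι j

end SumDecomposition

/-- Assemble decompositions of two complementary retracts of `X`. -/
def SumDecomposition.sum {J₁ J₂ : Type*} [Fintype J₁] [Fintype J₂] {S : J₁ ⊕ J₂ → C}
    {X Y K : C} (d₁ : SumDecomposition (fun j => S (.inl j)) Y)
    (d₂ : SumDecomposition (fun j => S (.inr j)) K) {f : Y ⟶ X} {r : X ⟶ Y}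
    {i : K ⟶ X} {p : X ⟶ K} (hf : f ≫ r = 𝟙 Y) (hi : i ≫ p = 𝟙 K) (hfp : f ≫ p = 0)
    (hir : i ≫ r = 0) (ht : r ≫ f + p ≫ i = 𝟙 X) : SumDecomposition S X where
  ι := fun | .inl j => d₁.ι j ≫ f | .inr j => d₂.ι j ≫ i
  π := fun | .inl j => r ≫ d₁.π j | .inr j => p ≫ d₂.π j
  ι_π_self := by
    rintro (j | j)
    · simp [reassoc_of% hf, d₁.ι_π_self]
    · simp [reassoc_of% hi, d₂.ι_π_self]
  ι_π_ne := by
    rintro (j | j) (j' | j') h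
    · simp [reassoc_of% hf, d₁.ι_π_ne fun e => h (congrArg _ e)]
    · simp [reassoc_of% hfp]
    · simp [reassoc_of% hir]
    · simp [reassoc_of% hi, d₂.ι_π_ne fun e => h (congrArg _ e)]
  total := by
    rw [Fintype.sum_sum_type]
    have h₁ := congrArg (fun x => r ≫ x ≫ f) d₁.total
    have h₂ := congrArg (fun x => p ≫ x ≫ i) d₂.total
    simp only [Preadditive.sum_comp, Preadditive.comp_sum, Category.id_comp, Category.assoc]
      at h₁ h₂
    simp only [Category.assoc]
    rw [h₁, h₂, ht]

variable (k : Type w) [Field k] [Linear k C]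

/-- Proper retracts have smaller endomorphism algebras. -/
theorem finrank_end_lt_of_retract {X Y : C} [FiniteDimensional k (X ⟶ X)] (i : Y ⟶ X) (p : X ⟶ Y)
    (h : i ≫ p = 𝟙 Y) (h' : p ≫ i ≠ 𝟙 X) :
    Module.finrank k (Y ⟶ Y) < Module.finrank k (X ⟶ X) := by
  let L : (Y ⟶ Y) →ₗ[k] (X ⟶ X) := (Linear.leftComp k X p).comp (Linear.rightComp k Y i)
  have hL : ∀ φ, L φ = p ≫ φ ≫ i := fun φ => rfl
  have hinj : Function.Injective L := by
    intro φ ψ e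
    rw [hL, hL] at e
    have := congrArg (fun x => i ≫ x ≫ p) e
    simpa [h, reassoc_of% h] using this
  have hlt : LinearMap.range L < ⊤ := by
    rw [lt_top_iff_ne_top]
    intro e
    obtain ⟨φ, hφ⟩ := LinearMap.range_eq_top.1 e (𝟙 X)
    rw [hL] at hφ
    have h₁ : φ ≫ i = i := by
      have := congrArg (fun x => i ≫ x) hφ
      simpa [reassoc_of% h] using this
    exact h' (by rw [← hφ, h₁])
  calc Module.finrank k (Y ⟶ Y) = Module.finrank k (LinearMap.range L) :=
        (LinearMap.finrank_range_of_inj hinj).symm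
    _ < _ := Submodule.finrank_lt hlt.ne

/-- The complement is the image of the idempotent `𝟙 X - p ≫ i`. -/
theorem exists_splitting_complement [IsIdempotentComplete C] {X Y : C} (i : Y ⟶ X) (p : X ⟶ Y)
    (h : i ≫ p = 𝟙 Y) :
    ∃ (K : C) (j : K ⟶ X) (q : X ⟶ K), j ≫ q = 𝟙 K ∧ i ≫ q = 0 ∧ j ≫ p = 0 ∧
      p ≫ i + q ≫ j = 𝟙 X := by
  obtain ⟨K, j, q, h₁, h₂⟩ := IsIdempotentComplete.idempotents_split X (𝟙 X - p ≫ i)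
    (by simp [reassoc_of% h])
  refine ⟨K, j, q, h₁, ?_, ?_, by rw [h₂]; abel⟩
  · have : i ≫ q ≫ j = 0 := by rw [h₂]; simp [reassoc_of% h]
    have h₃ := congrArg (· ≫ q) this
    simpa [h₁] using h₃
  · have : q ≫ j ≫ p = 0 := by rw [reassoc_of% h₂]; simp [h]
    have h₃ := congrArg (j ≫ ·) this
    simpa [reassoc_of% h₁] using h₃

/-- If `f ≫ g ≫ f = f`, then `f` has the same kernel as the idempotent `f ≫ g`, namely the image of
the complementary idempotent. Cokernels are dual. -/
theorem IsRegularCategory.hasKernels [IsIdempotentComplete C]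
    (hC : IsRegularCategory C) : HasKernels C where
  has_limit {X Y} f := by
    obtain ⟨g, hg⟩ := hC f
    obtain ⟨K, i, p, h₁, h₂⟩ := IsIdempotentComplete.idempotents_split X (𝟙 X - f ≫ g)
      (by simp [reassoc_of% hg])
    have hi : i ≫ f = 0 := by
      have : i ≫ p ≫ i ≫ f = 0 := by rw [reassoc_of% h₂]; simp [hg]
      simpa [reassoc_of% h₁] using this
    exact ⟨⟨KernelFork.ofι i hi, KernelFork.IsLimit.ofι i hi (fun t _ => t ≫ p)
      (fun t ht => by rw [Category.assoc, h₂]; simp [reassoc_of% ht])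
      (fun t _ m hm => by rw [← hm]; simp [h₁])⟩⟩

theorem IsRegularCategory.hasCokernels [IsIdempotentComplete C]
    (hC : IsRegularCategory C) : HasCokernels C where
  has_colimit {X Y} f := by
    obtain ⟨g, hg⟩ := hC f
    obtain ⟨K, i, p, h₁, h₂⟩ := IsIdempotentComplete.idempotents_split Y (𝟙 Y - g ≫ f)
      (by simp [hg])
    have hi : f ≫ p = 0 := by
      have : f ≫ p ≫ i ≫ p = 0 := by rw [reassoc_of% h₂]; simp [reassoc_of% hg]
      simpa [h₁] using this
    exact ⟨⟨CokernelCofork.ofπ p hi, CokernelCofork.IsColimit.ofπ p hi (fun t _ => i ≫ t)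
      (fun t ht => by rw [reassoc_of% h₂]; simp [ht])
      (fun t _ m hm => by rw [← hm]; simp [reassoc_of% h₁])⟩⟩

/-- A mono splits, and a split mono `f` with retraction `r` is a kernel of `𝟙 Y - r ≫ f`. -/
theorem IsRegularCategory.isNormalMonoCategory (hC : IsRegularCategory C) :
    IsNormalMonoCategory C where
  normalMonoOfMono {X Y} f _ := by
    obtain ⟨r, hr⟩ := hC.exists_retraction f
    have w : f ≫ (𝟙 Y - r ≫ f) = 0 := by simp [reassoc_of% hr]
    exact ⟨⟨Y, 𝟙 Y - r ≫ f, w, KernelFork.IsLimit.ofι f w (fun t _ => t ≫ r)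
      (fun t ht => by
        rw [Preadditive.comp_sub, sub_eq_zero, Category.comp_id] at ht; simpa using ht.symm)
      (fun t _ m hm => by rw [← hm]; simp [hr])⟩⟩

theorem IsRegularCategory.isNormalEpiCategory (hC : IsRegularCategory C) :
    IsNormalEpiCategory C where
  normalEpiOfEpi {X Y} f _ := by
    obtain ⟨r, hr⟩ := hC.exists_section f
    have w : (𝟙 X - f ≫ r) ≫ f = 0 := by simp [hr]
    exact ⟨⟨X, 𝟙 X - f ≫ r, w, CokernelCofork.IsColimit.ofπ f w (fun t _ => r ≫ t)
      (fun t ht => by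
        rw [Preadditive.sub_comp, sub_eq_zero, Category.id_comp] at ht; simpa using ht.symm)
      (fun t _ m hm => by rw [← hm]; simp [reassoc_of% hr])⟩⟩

theorem IsRegularCategory.isAbelianCategory [IsIdempotentComplete C]
    [HasFiniteProducts C] (hC : IsRegularCategory C) : IsAbelianCategory C where
  hasFiniteProducts := inferInstance
  hasKernels := hC.hasKernels
  hasCokernels := hC.hasCokernels
  normalMono := hC.isNormalMonoCategory
  normalEpi := hC.isNormalEpiCategory

/-- Induction on the dimension of the endomorphism algebra: a proper nonzero subobject splits off,
and both it and its complement have smaller endomorphism algebras. -/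
theorem IsRegularCategory.exists_sumDecomposition [IsIdempotentComplete C]
    (hC : IsRegularCategory C) (hfd : ∀ X : C, FiniteDimensional k (X ⟶ X)) :
    ∀ (X : C), ∃ (m : ℕ) (S : Fin m → C), (∀ j, Simple (S j)) ∧
      Nonempty (SumDecomposition S X) := by
  suffices h : ∀ (n : ℕ) (X : C), Module.finrank k (X ⟶ X) = n → ∃ (m : ℕ) (S : Fin m → C),
      (∀ j, Simple (S j)) ∧ Nonempty (SumDecomposition S X) from fun X => h _ X rfl
  intro n
  induction n using Nat.strong_induction_on with
  | _ n ih =>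
    intro X hX
    by_cases h0 : 𝟙 X = 0
    · exact ⟨0, Fin.elim0, fun j => j.elim0, ⟨⟨fun j => j.elim0, fun j => j.elim0,
        fun j => j.elim0, fun {j} => j.elim0, by simp [h0]⟩⟩⟩
    by_cases hs : Simple X
    · exact ⟨1, fun _ => X, fun _ => hs, ⟨⟨fun _ => 𝟙 X, fun _ => 𝟙 X, fun _ => by simp,
        fun h => absurd (Subsingleton.elim _ _) h, by simp⟩⟩⟩
    obtain ⟨Y, f, hf, hne⟩ : ∃ (Y : C) (f : Y ⟶ X) (_ : Mono f), ¬ (IsIso f ↔ f ≠ 0) := by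
      by_contra! hcon
      exact hs ⟨fun f hf => by
        exact hcon _ f hf⟩
    -- The mono `f` violates the equivalence defining simplicity. It cannot be both zero and
    -- invertible, as `X` is nonzero, so it is nonzero and not invertible.
    have hf0 : f ≠ 0 := by
      intro hf0
      refine hne ⟨fun hi => absurd ?_ h0, fun h => absurd hf0 h⟩
      have := IsIso.inv_hom_id f
      rw [← this]; nth_rw 2 [hf0]; exact comp_zero
    have hfi : ¬ IsIso f := fun hi => hne ⟨fun _ => hf0, fun _ => hi⟩
    obtain ⟨r, hr⟩ := hC.exists_retraction f
    obtain ⟨K, j, q, h₁, h₂, h₃, h₄⟩ := exists_splitting_complement f r hr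
    have := hfd X
    obtain ⟨m₁, S₁, hS₁, ⟨d₁⟩⟩ := ih _ (hX ▸ finrank_end_lt_of_retract k f r hr
      fun h => hfi ⟨r, hr, h⟩) Y rfl
    obtain ⟨m₂, S₂, hS₂, ⟨d₂⟩⟩ := ih _ (hX ▸ finrank_end_lt_of_retract k j q h₁ (fun h => by
      rw [h, add_eq_right] at h₄
      have := congrArg (f ≫ ·) h₄
      exact hf0 (by simpa [reassoc_of% hr] using this))) K rfl
    refine ⟨m₁ + m₂, _, ?_, ⟨(SumDecomposition.sum (S := Sum.elim S₁ S₂) d₁ d₂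
      hr h₁ h₂ h₃ h₄).reindex finSumFinEquiv.symm⟩⟩
    intro j
    rcases h : finSumFinEquiv.symm j with a | a
    · simpa [h] using hS₁ a
    · simpa [h] using hS₂ a

theorem hasFiniteLength_of_sumDecomposition [IsIdempotentComplete C] [HasZeroObject C] :
    ∀ (m : ℕ) (S : Fin m → C) (X : C), (∀ j, Simple (S j)) → SumDecomposition S X →
      HasFiniteLength X := by
  intro m
  induction m with
  | zero =>
    intro S X _ d
    refine .zero ((IsZero.iff_id_eq_zero X).2 ?_)
    rw [← d.total]; simp
  | succ m ih =>
    intro S X hS d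
    obtain ⟨K, j, q, h₁, h₂, h₃, h₄⟩ := exists_splitting_complement (d.ι 0) (d.π 0)
      (d.ι_π_self 0)
    have hq : ∀ a : Fin m, d.ι a.succ ≫ q ≫ j = d.ι a.succ := fun a => by
      have : q ≫ j = 𝟙 X - d.π 0 ≫ d.ι 0 := by rw [← h₄]; abel
      rw [this, Preadditive.comp_sub, reassoc_of% d.ι_π_ne (Fin.succ_ne_zero a)]
      simp
    have d' : SumDecomposition (fun a : Fin m => S a.succ) K :=
      { ι := fun a => d.ι a.succ ≫ q
        π := fun a => j ≫ d.π a.succ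
        ι_π_self := fun a => by
          rw [Category.assoc, ← Category.assoc q, ← Category.assoc, hq, d.ι_π_self]
        ι_π_ne := fun {a b} h => by
          rw [Category.assoc, ← Category.assoc q, ← Category.assoc, hq,
            d.ι_π_ne fun e => h (Fin.succ_injective _ e)]
        total := by
          have h := d.total
          rw [Fin.sum_univ_succ] at h
          have h := congrArg (fun x => j ≫ x ≫ q) h
          simpa [Preadditive.sum_comp, Preadditive.comp_sum, reassoc_of% h₃, h₁] using h }
    let T : ShortComplex C := ShortComplex.mk j (d.π 0) h₃
    have hT : T.ShortExact :=
      (ShortComplex.Splitting.mk (S := T) q (d.ι 0) h₁ (d.ι_π_self 0)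
        (by rw [add_comm]; exact h₄)).shortExact
    exact .extend T hT (ih _ K (fun a => hS _) d') (hS 0)

theorem IsRegularCategory.isFiniteSemisimpleAbelian [IsIdempotentComplete C]
    [HasFiniteProducts C] (hC : IsRegularCategory C)
    (hfd : ∀ X Y : C, FiniteDimensional k (X ⟶ Y))
    (hfin : {c : Quotient (isIsomorphicSetoid C) |
      ∃ X : C, Simple X ∧ Quotient.mk (isIsomorphicSetoid C) X = c}.Finite) :
    IsFiniteSemisimpleAbelian C k where
  isAbelian := hC.isAbelianCategory
  hasFiniteLength X := by
    obtain ⟨m, S, hS, ⟨d⟩⟩ := hC.exists_sumDecomposition k (fun X => hfd X X) X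
    have : HasZeroObject C := hasZeroObject_of_hasTerminal_object
    exact hasFiniteLength_of_sumDecomposition m S X hS d
  finiteDimensional_hom := hfd
  exists_projectiveCover X _ := ⟨X, 𝟙 X, hC.projective X, inferInstance,
    fun g _ _ => ⟨g, inferInstance, by simp⟩⟩
  finite_simples := hfin
  isSemisimple X := by
    obtain ⟨m, S, hS, ⟨d⟩⟩ := hC.exists_sumDecomposition k (fun X => hfd X X) X
    exact ⟨m, S, d.bicone, hS, d.isBilimit, ⟨Iso.refl _⟩⟩

end Decompositions

/-! ### Semisimple categories and representatives of the simple objects -/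

section Semisimple

variable {C : Type u} [Category.{v} C] [Preadditive C]

/-- The abelian category structure. -/
@[reducible]
noncomputable def IsAbelianCategory.abelian (h : IsAbelianCategory C) : Abelian C :=
  letI := h.normalMono
  letI := h.normalEpi
  { has_finite_products := h.hasFiniteProducts
    has_kernels := h.hasKernels
    has_cokernels := h.hasCokernels
    normalMonoOfMono := fun f _ => ⟨normalMonoOfMono f⟩
    normalEpiOfEpi := fun f _ => ⟨normalEpiOfEpi f⟩ }

/-- A semisimple object has a decomposition into simple objects. -/
theorem IsSemisimpleObject.exists_sumDecomposition {X : C} (h : IsSemisimpleObject X) :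
    ∃ (m : ℕ) (S : Fin m → C), (∀ j, Simple (S j)) ∧ Nonempty (SumDecomposition S X) := by
  obtain ⟨m, S, b, hS, ⟨hb⟩, ⟨e⟩⟩ := h
  exact ⟨m, S, hS, ⟨.ofIsBilimit hb e⟩⟩

/-- The epi `p` is nonzero on some simple summand of `X`, where Schur's lemma makes it an
isomorphism. -/
theorem exists_section_of_simple (hA : IsAbelianCategory C) (hC : ∀ X : C, IsSemisimpleObject X)
    {X S : C} [Simple S] (p : X ⟶ S) [Epi p] :
    ∃ s, s ≫ p = 𝟙 S := by
  have := hA.hasKernels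
  obtain ⟨m, T, hT, ⟨d⟩⟩ := (hC X).exists_sumDecomposition
  have : ∃ j, d.ι j ≫ p ≠ 0 := by
    by_contra! h
    have hp : p = 0 := by
      rw [← Category.id_comp p, ← d.total, Preadditive.sum_comp]
      exact Finset.sum_eq_zero fun j _ => by rw [Category.assoc, h, comp_zero]
    have h₁ : p ≫ 𝟙 S = p ≫ 0 := by simp [hp]
    exact id_nonzero S ((cancel_epi p).1 h₁)
  obtain ⟨j, hj⟩ := this
  have := hT j
  have := isIso_of_hom_simple hj
  exact ⟨inv (d.ι j ≫ p) ≫ d.ι j, by rw [Category.assoc, IsIso.inv_hom_id]⟩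

theorem projective_of_simple (hA : IsAbelianCategory C) (hC : ∀ X : C, IsSemisimpleObject X)
    (S : C) [Simple S] : Projective S where
  factors f e _ := by
    let _ := hA.abelian
    -- Lifting along `e` amounts to a section of the pullback of `e`, an epi onto a simple object.
    obtain ⟨s, hs⟩ := exists_section_of_simple hA hC (pullback.fst f e)
    exact ⟨s ≫ pullback.snd f e, by
      rw [Category.assoc, ← pullback.condition, reassoc_of% hs]⟩

theorem projective_of_isSemisimpleObject (hA : IsAbelianCategory C)
    (hC : ∀ X : C, IsSemisimpleObject X)
    (X : C) : Projective X where
  factors f e _ := by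
    obtain ⟨m, T, hT, ⟨d⟩⟩ := (hC X).exists_sumDecomposition
    have h : ∀ j, ∃ l, l ≫ e = d.ι j ≫ f := fun j =>
      have := projective_of_simple hA hC (T j)
      ⟨Projective.factorThru (d.ι j ≫ f) e, Projective.factorThru_comp _ _⟩
    choose l hl using h
    exact ⟨∑ j, d.π j ≫ l j, by
      simp only [Preadditive.sum_comp, Category.assoc, hl]
      simp only [← Category.assoc, ← Preadditive.sum_comp, d.total, Category.id_comp]⟩

theorem isRegularCategory_of_isSemisimpleObject (hA : IsAbelianCategory C)
    (hC : ∀ X : C, IsSemisimpleObject X)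
    : IsRegularCategory C := by
  intro X Y f
  let _ := hA.abelian
  have hP := projective_of_isSemisimpleObject hA hC
  let e := factorThruImage f
  let m := image.ι f
  have hf : e ≫ m = f := image.fac f
  obtain ⟨s, hs⟩ : ∃ s, s ≫ e = 𝟙 _ :=
    have := hP (image f)
    ⟨Projective.factorThru (𝟙 _) e, Projective.factorThru_comp _ _⟩
  -- A section of the cokernel of `m` gives a projection of `Y` onto the image, hence a retraction
  -- of `m`. The generalized inverse is this retraction followed by a section of `e`.
  obtain ⟨t, ht⟩ : ∃ t, t ≫ cokernel.π m = 𝟙 _ :=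
    have := hP (cokernel m)
    ⟨Projective.factorThru (𝟙 _) (cokernel.π m), Projective.factorThru_comp _ _⟩
  have hr : (𝟙 Y - cokernel.π m ≫ t) ≫ cokernel.π m = 0 := by simp [ht]
  have hr' := Abelian.monoLift_comp m _ hr
  set r := Abelian.monoLift m _ hr
  have hm : m ≫ r = 𝟙 _ := by
    rw [← cancel_mono m, Category.assoc, hr']
    simp
  exact ⟨r ≫ s, by
    have h : (e ≫ m) ≫ (r ≫ s) ≫ e ≫ m = e ≫ m := by
      simp only [Category.assoc]
      rw [reassoc_of% hm, reassoc_of% hs]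
    rwa [hf] at h⟩

variable (k : Type w) [Field k] [Linear k C]

/-- A decomposition of `X` as a direct sum of copies of the objects `a i`. -/
structure IsotypicDecomposition {I : Type*} [Fintype I] (a : I → C) (X : C) where
  mult : I → ℕ
  ι : ∀ i, Fin (mult i) → (a i ⟶ X)
  π : ∀ i, Fin (mult i) → (X ⟶ a i)
  ι_π_self : ∀ i r, ι i r ≫ π i r = 𝟙 (a i)
  ι_π_ne : ∀ i {r s}, r ≠ s → ι i r ≫ π i s = 0
  total : ∑ i, ∑ r, π i r ≫ ι i r = 𝟙 X

/-- Collect the summands of the same type. -/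
theorem SumDecomposition.nonempty_isotypic {I J : Type*} [Fintype I] [Fintype J] {a : I → C}
    {b : J → I} {X : C} (d : SumDecomposition (fun j => a (b j)) X) :
    Nonempty (IsotypicDecomposition a X) := by
  classical
  let e : ∀ i, Fin (Fintype.card {j // b j = i}) ≃ {j // b j = i} :=
    fun i => (Fintype.equivFin _).symm
  refine ⟨⟨fun i => Fintype.card {j // b j = i},
    fun i r => eqToHom (by rw [(e i r).2]) ≫ d.ι (e i r).1,
    fun i r => d.π (e i r).1 ≫ eqToHom (by rw [(e i r).2]), ?_, ?_, ?_⟩⟩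
  · intro i r
    simp [reassoc_of% d.ι_π_self]
  · intro i r s h
    have h' : (e i r).1 ≠ (e i s).1 := fun h' => h ((e i).injective (Subtype.ext h'))
    simp [reassoc_of% d.ι_π_ne h']
  · rw [← d.total, ← Fintype.sum_fiberwise b]
    refine Finset.sum_congr rfl fun i _ => ?_
    rw [← (e i).sum_comp]
    simp

/-- A finite family of objects with the Hom spaces of pairwise non-isomorphic simple objects over
an algebraically closed field, of which every object is a direct sum. -/
structure IsSimpleBasis {I : Type*} [Fintype I] (a : I → C) : Prop where
  hom_eq_zero : ∀ {i j}, i ≠ j → ∀ f : a i ⟶ a j, f = 0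
  exists_eq_smul : ∀ {i} (f : a i ⟶ a i), ∃ c : k, f = c • 𝟙 (a i)
  id_ne_zero : ∀ i, 𝟙 (a i) ≠ 0
  exists_isotypicDecomposition : ∀ X : C, Nonempty (IsotypicDecomposition a X)

theorem IsFiniteSemisimpleAbelian.exists_isSimpleBasis [IsAlgClosed k]
    (h : IsFiniteSemisimpleAbelian C k) :
    ∃ (N : ℕ) (a : Fin N → C), IsSimpleBasis k a := by
  have := h.isAbelian.hasKernels
  have := h.finite_simples.to_subtype
  obtain ⟨N, ⟨e⟩⟩ := Finite.exists_equiv_fin {c : Quotient (isIsomorphicSetoid C) |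
    ∃ X : C, Simple X ∧ Quotient.mk (isIsomorphicSetoid C) X = c}
  choose a ha ha' using fun i => (e.symm i).2
  have hiso : ∀ S : C, Simple S → ∃ i, Nonempty (S ≅ a i) := fun S hS => by
    refine ⟨e ⟨_, S, hS, rfl⟩, ?_⟩
    have h₁ := ha' (e ⟨_, S, hS, rfl⟩)
    rw [Equiv.symm_apply_apply] at h₁
    exact (Quotient.exact h₁).map Iso.symm
  refine ⟨N, a, ?_, ?_, fun i => @id_nonzero _ _ _ _ (ha i), ?_⟩
  · intro i j hij f
    have := ha i
    have := ha j
    by_contra hf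
    have := isIso_of_hom_simple hf
    refine hij (e.symm.injective (Subtype.ext ?_))
    rw [← ha' i, ← ha' j]
    exact Quotient.sound ⟨asIso f⟩
  · intro i f
    have := ha i
    have := h.finiteDimensional_hom (a i) (a i)
    obtain ⟨c, hc⟩ := endomorphism_simple_eq_smul_id k f
    exact ⟨c, hc.symm⟩
  · intro X
    obtain ⟨m, S, hS, ⟨d⟩⟩ := (h.isSemisimple X).exists_sumDecomposition
    choose b hb using fun j => hiso (S j) (hS j)
    exact (d.congr fun j => (hb j).some).nonempty_isotypic

/-! ### Multiplicities as dimensions of Hom spaces. -/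

namespace IsSimpleBasis

variable {k} {I : Type*} [Fintype I] {a : I → C}

/-- Two parallel morphisms agree when they agree on all morphisms from the simple objects. -/
theorem hom_ext (ha : IsSimpleBasis k a) {X Y : C} {f g : X ⟶ Y}
    (h : ∀ i (t : a i ⟶ X), t ≫ f = t ≫ g) : f = g := by
  obtain ⟨d⟩ := ha.exists_isotypicDecomposition X
  rw [← Category.id_comp f, ← Category.id_comp g, ← d.total]
  simp only [Preadditive.sum_comp, Category.assoc, h]

variable {X : C}

theorem exists_eq_sum_ι (ha : IsSimpleBasis k a) (d : IsotypicDecomposition a X) {i : I}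
    (t : a i ⟶ X) : ∃ c : Fin (d.mult i) → k, t = ∑ r, c r • d.ι i r := by
  choose c hc using fun r => ha.exists_eq_smul (t ≫ d.π i r)
  refine ⟨c, ?_⟩
  conv_lhs => rw [← Category.comp_id t, ← d.total, Preadditive.comp_sum]
  rw [Finset.sum_eq_single i]
  · rw [Preadditive.comp_sum]
    refine Finset.sum_congr rfl fun r _ => ?_
    rw [← Category.assoc, hc]
    simp
  · intro j _ hj
    rw [Preadditive.comp_sum]
    refine Finset.sum_eq_zero fun r _ => ?_
    rw [← Category.assoc, ha.hom_eq_zero hj.symm (t ≫ d.π j r), zero_comp]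
  · simp

theorem exists_eq_sum_π (ha : IsSimpleBasis k a) (d : IsotypicDecomposition a X) {i : I}
    (t : X ⟶ a i) : ∃ c : Fin (d.mult i) → k, t = ∑ r, c r • d.π i r := by
  choose c hc using fun r => ha.exists_eq_smul (d.ι i r ≫ t)
  refine ⟨c, ?_⟩
  conv_lhs => rw [← Category.id_comp t, ← d.total, Preadditive.sum_comp]
  rw [Finset.sum_eq_single i]
  · rw [Preadditive.sum_comp]
    refine Finset.sum_congr rfl fun r _ => ?_
    rw [Category.assoc, hc]
    simp
  · intro j _ hj
    rw [Preadditive.sum_comp]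
    refine Finset.sum_eq_zero fun r _ => ?_
    rw [Category.assoc, ha.hom_eq_zero hj (d.ι j r ≫ t), comp_zero]
  · simp

theorem finrank_hom_from (ha : IsSimpleBasis k a) (d : IsotypicDecomposition a X) (i : I) :
    Module.finrank k (a i ⟶ X) = d.mult i := by
  have hli : LinearIndependent k (d.ι i) := by
    rw [Fintype.linearIndependent_iff]
    intro c hc r
    have h := congrArg (· ≫ d.π i r) hc
    simp only [Preadditive.sum_comp, zero_comp, Linear.smul_comp] at h
    rw [Finset.sum_eq_single r (fun s _ hs => by rw [d.ι_π_ne i hs, smul_zero]) (by simp),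
      d.ι_π_self] at h
    exact (smul_eq_zero.1 h).resolve_right (ha.id_ne_zero i)
  have hsp : ⊤ ≤ Submodule.span k (Set.range (d.ι i)) := by
    rintro t -
    obtain ⟨c, rfl⟩ := ha.exists_eq_sum_ι d t
    exact Submodule.sum_mem _ fun r _ =>
      Submodule.smul_mem _ _ (Submodule.subset_span ⟨r, rfl⟩)
  rw [Module.finrank_eq_card_basis (Module.Basis.mk hli hsp), Fintype.card_fin]

theorem finrank_hom_to (ha : IsSimpleBasis k a) (d : IsotypicDecomposition a X) (i : I) :
    Module.finrank k (X ⟶ a i) = d.mult i := by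
  have hli : LinearIndependent k (d.π i) := by
    rw [Fintype.linearIndependent_iff]
    intro c hc r
    have h := congrArg (d.ι i r ≫ ·) hc
    simp only [Preadditive.comp_sum, comp_zero, Linear.comp_smul] at h
    rw [Finset.sum_eq_single r (fun s _ hs => by rw [d.ι_π_ne i hs.symm, smul_zero]) (by simp),
      d.ι_π_self] at h
    exact (smul_eq_zero.1 h).resolve_right (ha.id_ne_zero i)
  have hsp : ⊤ ≤ Submodule.span k (Set.range (d.π i)) := by
    rintro t -
    obtain ⟨c, rfl⟩ := ha.exists_eq_sum_π d t
    exact Submodule.sum_mem _ fun r _ =>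
      Submodule.smul_mem _ _ (Submodule.subset_span ⟨r, rfl⟩)
  rw [Module.finrank_eq_card_basis (Module.Basis.mk hli hsp), Fintype.card_fin]

end IsSimpleBasis

end Semisimple

/-! ### Traces in ribbon categories -/

section Traces

open BraidedCategory

variable {C : Type u} [Category.{v} C] [MonoidalCategory C] [BraidedCategory C]

/-- The double braiding followed by the evaluation of the left factors with their duals. -/
theorem double_braiding_comp_braiding_comp_evaluation {X Y Z : C} [ExactPairing X Z] :
    ((β_ X Y).hom ≫ (β_ Y X).hom) ▷ Z ≫ (β_ (X ⊗ Y) Z).hom ≫ (α_ Z X Y).inv ≫ ε_ X Z ▷ Y ≫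
      (λ_ Y).hom =
    (β_ X Y).hom ▷ Z ≫ (α_ Y X Z).hom ≫ Y ◁ ((β_ X Z).hom ≫ ε_ X Z) ≫ (ρ_ Y).hom := by
  have h := braiding_naturality_right Y (ε_ X Z)
  rw [braiding_tensor_right_hom] at h
  calc _ = (β_ X Y).hom ▷ Z ≫ ((β_ Y X).hom ▷ Z ≫ (β_ (X ⊗ Y) Z).hom) ≫ (α_ Z X Y).inv ≫
        ε_ X Z ▷ Y ≫ (λ_ Y).hom := by simp
    _ = (β_ X Y).hom ▷ Z ≫ (α_ Y X Z).hom ≫ Y ◁ (β_ X Z).hom ≫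
        (((α_ Y Z X).inv ≫ (β_ Y Z).hom ▷ X ≫ (α_ Z Y X).hom ≫ Z ◁ (β_ Y X).hom ≫
          (α_ Z X Y).inv) ≫ ε_ X Z ▷ Y) ≫ (λ_ Y).hom := by
      rw [braiding_naturality_left, braiding_tensor_left_hom]; simp
    _ = _ := by
      rw [← h]; simp

/-- A strand crossing both legs of a cap can be pulled off it, by naturality of the braiding and the
hexagon. -/
theorem braiding_comp_braiding_comp_evaluation {X Y Z : C} [ExactPairing Y Z] :
    (β_ X Z).hom ▷ Y ≫ (α_ Z X Y).hom ≫ Z ◁ (β_ X Y).hom ≫ (α_ Z Y X).inv ≫ ε_ Y Z ▷ X ≫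
      (λ_ X).hom = (α_ X Z Y).hom ≫ X ◁ ε_ Y Z ≫ (ρ_ X).hom := by
  have h := braiding_naturality_right X (ε_ Y Z)
  rw [braiding_tensor_right_hom] at h
  have h' := congrArg (fun x => (α_ X Z Y).hom ≫ x ≫ (λ_ X).hom) h
  simpa using h'.symm

/-- The double braiding is the one contained in the twist of `X ⊗ Y`. It undoes the entanglement of
the two strands, and nested caps remain. -/
theorem double_braiding_comp_evaluation_tensor {X Y X' Y' : C} [ExactPairing X X']
    [ExactPairing Y Y'] :
    ((β_ X Y).hom ≫ (β_ Y X).hom) ▷ (Y' ⊗ X') ≫ (β_ (X ⊗ Y) (Y' ⊗ X')).hom ≫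
        ε_ (X ⊗ Y) (Y' ⊗ X') =
      𝟙 _ ⊗≫ X ◁ ((β_ Y Y').hom ≫ ε_ Y Y') ▷ X' ⊗≫ (β_ X X').hom ≫ ε_ X X' := by
  have hD : ((β_ X Y).hom ≫ (β_ Y X).hom) ▷ Y' ≫ (β_ (X ⊗ Y) Y').hom =
      (β_ (X ⊗ Y) Y').hom ≫ Y' ◁ ((β_ X Y).hom ≫ (β_ Y X).hom) :=
    braiding_naturality_left _ _
  have h₁ := double_braiding_comp_braiding_comp_evaluation (X := X) (Y := Y) (Z := X')
  have h₂ := braiding_comp_braiding_comp_evaluation (X := X) (Y := Y) (Z := Y')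
  rw [ExactPairing.tensor_evaluation]
  calc
    _ = 𝟙 _ ⊗≫ (((β_ X Y).hom ≫ (β_ Y X).hom) ▷ Y' ≫ (β_ (X ⊗ Y) Y').hom) ▷ X' ⊗≫
        Y' ◁ (β_ (X ⊗ Y) X').hom ⊗≫ Y' ◁ (ε_ X X' ▷ Y) ⊗≫ ε_ Y Y' := by
      rw [braiding_tensor_right_hom]; monoidal
    _ = 𝟙 _ ⊗≫ (β_ (X ⊗ Y) Y').hom ▷ X' ⊗≫ Y' ◁ (((β_ X Y).hom ≫ (β_ Y X).hom) ▷ X' ≫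
        (β_ (X ⊗ Y) X').hom ≫ (α_ X' X Y).inv ≫ ε_ X X' ▷ Y ≫ (λ_ Y).hom) ⊗≫ ε_ Y Y' := by
      rw [hD]; monoidal
    _ = 𝟙 _ ⊗≫ X ◁ (β_ Y Y').hom ▷ X' ⊗≫ (β_ X Y').hom ▷ Y ▷ X' ⊗≫ Y' ◁ (β_ X Y).hom ▷ X' ⊗≫
        ((Y' ⊗ Y) ◁ ((β_ X X').hom ≫ ε_ X X') ≫ ε_ Y Y' ▷ 𝟙_ C) ⊗≫ 𝟙 _ := by
      rw [h₁, braiding_tensor_left_hom]; monoidal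
    _ = 𝟙 _ ⊗≫ X ◁ (β_ Y Y').hom ▷ X' ⊗≫ ((β_ X Y').hom ▷ Y ≫ (α_ Y' X Y).hom ≫
        Y' ◁ (β_ X Y).hom ≫ (α_ Y' Y X).inv ≫ ε_ Y Y' ▷ X ≫ (λ_ X).hom) ▷ X' ⊗≫
        (β_ X X').hom ≫ ε_ X X' := by
      rw [whisker_exchange]; monoidal
    _ = _ := by
      rw [h₂]; monoidal

variable [RigidCategory C] (R : RibbonStructure C)

/-! ### Twisted evaluations, partial traces and traces. -/

namespace RibbonStructure

/-- The twist of an object. -/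
def θ (X : C) : X ⟶ X := R.twist.hom.app X

theorem θ_naturality {X Y : C} (f : X ⟶ Y) : f ≫ R.θ Y = R.θ X ≫ f :=
  R.twist.hom.naturality f

theorem θ_tensor (X Y : C) :
    R.θ (X ⊗ Y) = R.θ X ▷ Y ≫ X ◁ R.θ Y ≫ (β_ X Y).hom ≫ (β_ Y X).hom := by
  have h := R.twist_tensor X Y
  change R.θ (X ⊗ Y) = _ ≫ _ ≫ (R.θ X ⊗ₘ R.θ Y) at h
  rw [h, ← braiding_naturality, ← braiding_naturality_assoc, MonoidalCategory.tensorHom_def]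
  simp

theorem θ_dual (X : C) : (R.θ X)ᘁ = R.θ (Xᘁ) := R.twist_dual X

/-- The evaluation of an object against its right dual from the right, defined by the twist. -/
def ev (X X' : C) [ExactPairing X X'] : X ⊗ X' ⟶ 𝟙_ C :=
  R.θ X ▷ X' ≫ (β_ X X').hom ≫ ε_ X X'

theorem ev_tensor (X Y X' Y' : C) [ExactPairing X X'] [ExactPairing Y Y'] :
    R.ev (X ⊗ Y) (Y' ⊗ X') = 𝟙 _ ⊗≫ X ◁ R.ev Y Y' ▷ X' ⊗≫ R.ev X X' := by
  have h := double_braiding_comp_evaluation_tensor (X := X) (Y := Y) (X' := X') (Y' := Y')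
  rw [ev, θ_tensor]
  calc _ = R.θ X ▷ Y ▷ (Y' ⊗ X') ≫ (X ◁ R.θ Y) ▷ (Y' ⊗ X') ≫
        (((β_ X Y).hom ≫ (β_ Y X).hom) ▷ (Y' ⊗ X') ≫ (β_ (X ⊗ Y) (Y' ⊗ X')).hom ≫
        ε_ (X ⊗ Y) (Y' ⊗ X')) := by simp only [comp_whiskerRight, Category.assoc]
    _ = 𝟙 _ ⊗≫ (R.θ X ▷ (Y ⊗ Y') ≫ X ◁ R.ev Y Y') ▷ X' ⊗≫ (β_ X X').hom ≫ ε_ X X' := by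
      rw [h, ev]; monoidal
    _ = _ := by
      rw [← whisker_exchange, ev, ev]; monoidal

/-- The partial trace of a morphism over the right tensor factor. -/
def ptr {Y Z : C} (X X' : C) [ExactPairing X X'] (f : Y ⊗ X ⟶ Z ⊗ X) : Y ⟶ Z :=
  (ρ_ Y).inv ≫ Y ◁ η_ X X' ≫ (α_ Y X X').inv ≫ f ▷ X' ≫ (α_ Z X X').hom ≫ Z ◁ R.ev X X' ≫
    (ρ_ Z).hom

/-- The trace of an endomorphism. -/
def tr (X X' : C) [ExactPairing X X'] (f : X ⟶ X) : 𝟙_ C ⟶ 𝟙_ C :=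
  η_ X X' ≫ f ▷ X' ≫ R.ev X X'

/-- The coevaluation turns `f` into its mate on the dual strand, and the twisted evaluation turns
the mate back into `f` on the other side of `g`. With an identity for one of the morphisms, it shows
that the trace does not depend on the chosen dual. -/
theorem tr_comp_comm {X X' Y Y' : C} [hX : ExactPairing X X'] [hY : ExactPairing Y Y'] (f : X ⟶ Y)
    (g : Y ⟶ X) : R.tr X X' (f ≫ g) = R.tr Y Y' (g ≫ f) := by
  have h₁ := @coevaluation_comp_rightAdjointMate C _ _ X Y ⟨X'⟩ ⟨Y'⟩ f
  have h₂ := @rightAdjointMate_comp_evaluation C _ _ X Y ⟨X'⟩ ⟨Y'⟩ f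
  set m : Y' ⟶ X' := @rightAdjointMate C _ _ X Y ⟨X'⟩ ⟨Y'⟩ f
  change η_ Y Y' ≫ Y ◁ m = η_ X X' ≫ f ▷ X' at h₁
  change m ▷ X ≫ ε_ X X' = Y' ◁ f ≫ ε_ Y Y' at h₂
  have h₃ : X ◁ m ≫ R.ev X X' = f ▷ Y' ≫ R.ev Y Y' := by
    rw [ev, ev, whisker_exchange_assoc, braiding_naturality_right_assoc, h₂,
      ← braiding_naturality_left_assoc, ← comp_whiskerRight_assoc, ← comp_whiskerRight_assoc,
      θ_naturality]
  rw [tr, tr, comp_whiskerRight, Category.assoc, ← reassoc_of% h₁, whisker_exchange_assoc, h₃,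
    comp_whiskerRight, Category.assoc]

theorem tr_tensor {X X' Y Y' : C} [ExactPairing X X'] [ExactPairing Y Y'] (f : X ⊗ Y ⟶ X ⊗ Y) :
    R.tr (X ⊗ Y) (Y' ⊗ X') f = R.tr X X' (R.ptr Y Y' f) := by
  rw [tr, ev_tensor, ExactPairing.tensor_coevaluation, tr, ptr]
  monoidal

/-- The trace of an endomorphism which factors through a tensor product, as an iterated trace. -/
theorem tr_comp_eq_tr_ptr {X X' Y Y' Z Z' : C} [ExactPairing X X'] [ExactPairing Y Y']
    [ExactPairing Z Z'] (i : Z ⟶ X ⊗ Y) (p : X ⊗ Y ⟶ Z) :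
    R.tr Z Z' (i ≫ p) = R.tr X X' (R.ptr Y Y' (p ≫ i)) := by
  rw [← tr_tensor]
  exact R.tr_comp_comm i p

/-- The trace of an endomorphism of a dual object. -/
theorem tr_rightDual {X Y : C} [ExactPairing (Xᘁ) Y] (f : Xᘁ ⟶ Xᘁ) :
    R.tr (Xᘁ) Y f = η_ X (Xᘁ) ≫ X ◁ f ≫ R.ev X (Xᘁ) := by
  -- The dual of `Xᘁ` may be taken to be `X`, paired through the braiding.
  have h : R.tr (Xᘁ) Y f = @tr _ _ _ _ _ R (Xᘁ) X (exactPairing_swap X (Xᘁ)) f := by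
    let _ := exactPairing_swap X (Xᘁ)
    simpa using R.tr_comp_comm (X' := Y) (Y' := X) f (𝟙 _)
  have hη : @ExactPairing.coevaluation C _ _ (Xᘁ) X (exactPairing_swap X (Xᘁ)) =
      η_ X (Xᘁ) ≫ (β_ (Xᘁ) X).inv := rfl
  have hε : @ExactPairing.evaluation C _ _ (Xᘁ) X (exactPairing_swap X (Xᘁ)) =
      (β_ X (Xᘁ)).hom ≫ ε_ X (Xᘁ) := rfl
  -- Here the compatibility of the twist with duals enters: the twist moves from `Xᘁ` to `X`.
  have hθ : X ◁ R.θ (Xᘁ) ≫ (β_ X (Xᘁ)).hom ≫ ε_ X (Xᘁ) = R.ev X (Xᘁ) := by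
    rw [braiding_naturality_right_assoc, ← θ_dual, rightAdjointMate_comp_evaluation,
      ← braiding_naturality_left_assoc, ev]
  rw [h, tr, ev, hη, hε, ← hθ]
  simp only [Category.assoc]
  rw [← comp_whiskerRight_assoc, braiding_naturality_left_assoc, Iso.inv_hom_id_assoc]
  simp

/-- Both sides are the same closed diagram. The interchange law decides whether the loop on the left
or the one on the right is closed first. -/
theorem coevaluation_comp_ptr_comp_ev {X X' Y Y' : C} [ExactPairing X X'] [ExactPairing Y Y']
    (f : X' ⊗ Y ⟶ X' ⊗ Y) :
    η_ X X' ≫ X ◁ R.ptr Y Y' f ≫ R.ev X X' =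
      R.tr Y Y' ((λ_ Y).inv ≫ η_ X X' ▷ Y ≫ (α_ X X' Y).hom ≫ X ◁ f ≫ (α_ X X' Y).inv ≫
        R.ev X X' ▷ Y ≫ (λ_ Y).hom) := by
  rw [ptr, tr]
  calc _ = 𝟙 _ ⊗≫ (η_ X X' ▷ 𝟙_ C ≫ (X ⊗ X') ◁ η_ Y Y') ⊗≫ X ◁ f ▷ Y' ⊗≫
        ((X ⊗ X') ◁ R.ev Y Y' ≫ R.ev X X' ▷ 𝟙_ C) ⊗≫ 𝟙 _ := by monoidal
    _ = 𝟙 _ ⊗≫ (𝟙_ C ◁ η_ Y Y' ≫ η_ X X' ▷ (Y ⊗ Y')) ⊗≫ X ◁ f ▷ Y' ⊗≫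
        (R.ev X X' ▷ (Y ⊗ Y') ≫ 𝟙_ C ◁ R.ev Y Y') ⊗≫ 𝟙 _ := by
      rw [whisker_exchange, whisker_exchange]
    _ = _ := by monoidal

end RibbonStructure

end Traces

/-! ### Killing property of the weighted sum over the simple objects -/

section Mates

variable {C : Type u} [Category.{v} C] [MonoidalCategory C]

theorem rightAdjointMate_surjective {X Y : C} [HasRightDual X] [HasRightDual Y] (f : Yᘁ ⟶ Xᘁ) :
    ∃ g : X ⟶ Y, gᘁ = f := by
  refine ⟨(λ_ X).inv ≫ (tensorRightHomEquiv (𝟙_ C) X (Xᘁ) Y).symm (η_ Y (Yᘁ) ≫ Y ◁ f), ?_⟩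
  set g := (tensorRightHomEquiv (𝟙_ C) X (Xᘁ) Y).symm (η_ Y (Yᘁ) ≫ Y ◁ f)
  have hg : tensorRightHomEquiv (𝟙_ C) X (Xᘁ) Y g = η_ Y (Yᘁ) ≫ Y ◁ f :=
    Equiv.apply_symm_apply _ _
  have h := coevaluation_comp_rightAdjointMate ((λ_ X).inv ≫ g)
  have h' : η_ X (Xᘁ) ≫ ((λ_ X).inv ≫ g) ▷ Xᘁ = tensorRightHomEquiv (𝟙_ C) X (Xᘁ) Y g := by
    simp only [tensorRightHomEquiv, Equiv.coe_fn_mk]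
    monoidal
  rw [h', hg] at h
  have h₂ := congrArg (tensorLeftHomEquiv (𝟙_ C) Y (Yᘁ) (Xᘁ)).symm h
  rw [tensorLeftHomEquiv_symm_coevaluation_comp_whiskerLeft,
    tensorLeftHomEquiv_symm_coevaluation_comp_whiskerLeft] at h₂
  exact (cancel_epi _).1 h₂

variable [Preadditive C] [MonoidalPreadditive C]

theorem rightAdjointMate_zero {X Y : C} [HasRightDual X] [HasRightDual Y] :
    (0 : X ⟶ Y)ᘁ = 0 := by
  simp [rightAdjointMate]

theorem rightAdjointMate_sum {X Y : C} [HasRightDual X] [HasRightDual Y] {J : Type*}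
    (s : Finset J) (f : J → (X ⟶ Y)) : (∑ j ∈ s, f j)ᘁ = ∑ j ∈ s, (f j)ᘁ := by
  simp [rightAdjointMate, whiskerLeft_sum, sum_whiskerRight, Preadditive.comp_sum,
    Preadditive.sum_comp]

variable {k : Type w} [Field k] [Linear k C] [MonoidalLinear k C]

theorem rightAdjointMate_smul {X Y : C} [HasRightDual X] [HasRightDual Y] (c : k) (f : X ⟶ Y) :
    (c • f)ᘁ = c • fᘁ := by
  simp [rightAdjointMate]

/-- The duals of the simple objects represent the simple objects. -/
theorem IsSimpleBasis.rightDual [RigidCategory C] {I : Type*} [Fintype I] {a : I → C}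
    (ha : IsSimpleBasis k a) : IsSimpleBasis k fun i => (a i)ᘁ where
  hom_eq_zero {i j} hij f := by
    obtain ⟨g, rfl⟩ := rightAdjointMate_surjective f
    rw [ha.hom_eq_zero hij.symm g, rightAdjointMate_zero]
  exists_eq_smul {i} f := by
    obtain ⟨g, rfl⟩ := rightAdjointMate_surjective f
    obtain ⟨c, rfl⟩ := ha.exists_eq_smul g
    exact ⟨c, by rw [rightAdjointMate_smul, rightAdjointMate_id]⟩
  id_ne_zero i h := by
    refine ha.id_ne_zero i ?_
    have h₁ := ExactPairing.evaluation_coevaluation (a i) ((a i)ᘁ)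
    have h₂ : η_ (a i) ((a i)ᘁ) = 0 := by
      rw [← Category.comp_id (η_ (a i) ((a i)ᘁ)), ← whiskerLeft_id, h]; simp
    rw [h₂] at h₁
    have h₃ : (λ_ (a i)).inv ≫ ((λ_ (a i)).hom ≫ (ρ_ (a i)).inv) ≫ (ρ_ (a i)).hom = 0 := by
      rw [← h₁]; simp
    simpa using h₃
  exists_isotypicDecomposition X := by
    -- Since `X` is the right dual of `ᘁX`, dualizing a decomposition of `ᘁX` gives one of `X`.
    obtain ⟨d⟩ := ha.exists_isotypicDecomposition (ᘁX)
    let _ : HasRightDual (ᘁX) := hasRightDualLeftDual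
    refine ⟨⟨d.mult, fun i r => (d.π i r)ᘁ, fun i r => (d.ι i r)ᘁ, ?_, ?_, ?_⟩⟩
    · intro i r
      rw [← comp_rightAdjointMate, d.ι_π_self, rightAdjointMate_id]
    · intro i r s hrs
      rw [← comp_rightAdjointMate, d.ι_π_ne i hrs.symm, rightAdjointMate_zero]
    · have h := congrArg (fun f : (ᘁX : C) ⟶ (ᘁX : C) => rightAdjointMate f) d.total
      simp only [rightAdjointMate_sum, comp_rightAdjointMate, rightAdjointMate_id] at h
      exact h

end Mates

section Killing

variable {C : Type u} [Category.{v} C] [MonoidalCategory C]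

/-- A morphism `X ⊗ W ⟶ Y ⊗ W` obtained by applying `E : X ⊗ Z ⟶ Y ⊗ Z` inside of `W`. -/
def applyInside {X Y W Z Q : C} (E : X ⊗ Z ⟶ Y ⊗ Z) (p : W ⟶ Z ⊗ Q) (q : Z ⊗ Q ⟶ W) :
    X ⊗ W ⟶ Y ⊗ W :=
  X ◁ p ≫ (α_ X Z Q).inv ≫ E ▷ Q ≫ (α_ Y Z Q).hom ≫ Y ◁ q

theorem applyInside_whiskerLeft {X Y W Z Q Q' : C} (E : X ⊗ Z ⟶ Y ⊗ Z) (p : W ⟶ Z ⊗ Q)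
    (q : Z ⊗ Q' ⟶ W) (f : Q ⟶ Q') :
    applyInside E (p ≫ Z ◁ f) q = applyInside E p (Z ◁ f ≫ q) := by
  have h := whisker_exchange E f
  calc _ = X ◁ p ⊗≫ ((X ⊗ Z) ◁ f ≫ E ▷ Q') ⊗≫ Y ◁ q := by
        rw [applyInside]; monoidal
    _ = _ := by rw [h, applyInside]; monoidal

/-- Naturality of the family containing `E` and `E'` carries `f` from before it to after it. -/
theorem applyInside_whiskerRight {X Y W Z Z' Q : C} {E : X ⊗ Z ⟶ Y ⊗ Z} {E' : X ⊗ Z' ⟶ Y ⊗ Z'}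
    (p : W ⟶ Z ⊗ Q) (q : Z' ⊗ Q ⟶ W) (f : Z ⟶ Z') (h : X ◁ f ≫ E' = E ≫ Y ◁ f) :
    applyInside E' (p ≫ f ▷ Q) q = applyInside E p (f ▷ Q ≫ q) := by
  calc _ = X ◁ p ⊗≫ (X ◁ f ≫ E') ▷ Q ⊗≫ Y ◁ q := by
        rw [applyInside]; monoidal
    _ = _ := by rw [h, applyInside]; monoidal

/-- Coevaluation on the right of an object. -/
def cupRight (W X X' : C) [ExactPairing X X'] : W ⟶ (W ⊗ X) ⊗ X' :=
  (ρ_ W).inv ≫ W ◁ η_ X X' ≫ (α_ W X X').inv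

theorem cupRight_naturality {W W' : C} (f : W ⟶ W') (X X' : C) [ExactPairing X X'] :
    cupRight W X X' ≫ f ▷ X ▷ X' = f ≫ cupRight W' X X' := by
  have h := whisker_exchange f (η_ X X')
  rw [cupRight, cupRight, rightUnitor_inv_naturality_assoc, ← reassoc_of% h]
  simp

/-- Coevaluation on the left of an object. -/
def cupLeft (W X X' : C) [ExactPairing X X'] : W ⟶ X ⊗ (X' ⊗ W) :=
  (λ_ W).inv ≫ η_ X X' ▷ W ≫ (α_ X X' W).hom

theorem exists_cupLeft_comp_whiskerLeft {W X X' T : C} [ExactPairing X X'] (f : W ⟶ X ⊗ T) :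
    ∃ g : X' ⊗ W ⟶ T, cupLeft W X X' ≫ X ◁ g = f :=
  ⟨(tensorLeftHomEquiv W X X' T).symm f, by
    have h := (tensorLeftHomEquiv W X X' T).apply_symm_apply f
    simpa only [tensorLeftHomEquiv, Equiv.coe_fn_mk, cupLeft, Category.assoc] using h⟩

/-! ### Bending strands with cups and caps. -/

section Cups

variable [BraidedCategory C] [RigidCategory C] (R : RibbonStructure C)

namespace RibbonStructure

/-- Evaluation on the right of an object. -/
def capRight (W X X' : C) [ExactPairing X X'] : (W ⊗ X) ⊗ X' ⟶ W :=
  (α_ W X X').hom ≫ W ◁ R.ev X X' ≫ (ρ_ W).hom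

/-- Evaluation on the left of an object. -/
def capLeft (W X X' : C) [ExactPairing X X'] : X ⊗ (X' ⊗ W) ⟶ W :=
  (α_ X X' W).inv ≫ R.ev X X' ▷ W ≫ (λ_ W).hom

theorem capRight_naturality {W W' : C} (f : W ⟶ W') (X X' : C) [ExactPairing X X'] :
    f ▷ X ▷ X' ≫ R.capRight W' X X' = R.capRight W X X' ≫ f := by
  have h := whisker_exchange f (R.ev X X')
  rw [capRight, capRight, Category.assoc, Category.assoc, ← rightUnitor_naturality,
    reassoc_of% h]
  simp

theorem ptr_eq_cup_cap {Y Z : C} (X X' : C) [ExactPairing X X'] (f : Y ⊗ X ⟶ Z ⊗ X) :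
    R.ptr X X' f = cupRight Y X X' ≫ f ▷ X' ≫ R.capRight Z X X' := by
  simp [ptr, cupRight, capRight]

/-- The exact pairing with evaluation `R.ev X X'`. -/
@[reducible]
def exactPairingSymm (X X' : C) [ExactPairing X X'] : ExactPairing X' X :=
  let _ := BraidedCategory.exactPairing_swap X X'
  exactPairingCongrRight (X := X') (Y := X) (Y' := X) (R.twist.app X)

theorem exists_whiskerLeft_comp_capLeft {W X X' T : C} [ExactPairing X X'] (f : X ⊗ T ⟶ W) :
    ∃ g : T ⟶ X' ⊗ W, X ◁ g ≫ R.capLeft W X X' = f := by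
  let _ := R.exactPairingSymm X X'
  exact ⟨tensorLeftHomEquiv T X' X W f, (tensorLeftHomEquiv T X' X W).symm_apply_apply f⟩

theorem whiskerLeft_comp_capLeft_injective {W X X' T : C} [ExactPairing X X']
    {g g' : T ⟶ X' ⊗ W} (h : X ◁ g ≫ R.capLeft W X X' = X ◁ g' ≫ R.capLeft W X X') : g = g' := by
  let _ := R.exactPairingSymm X X'
  exact (tensorLeftHomEquiv T X' X W).symm.injective h

theorem exists_capRight {W X X' T : C} [ExactPairing X X'] (f : T ⊗ X' ⟶ W) :
    ∃ g : T ⟶ W ⊗ X, g ▷ X' ≫ R.capRight W X X' = f := by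
  let _ := R.exactPairingSymm X X'
  exact ⟨tensorRightHomEquiv T X' X W f, (tensorRightHomEquiv T X' X W).symm_apply_apply f⟩

/-- Together with `applyInside_cupLeft`, this expresses the two sides of the killing property: `W`
runs through `E` when the loop closes on its right, and is a spectator when the loop closes on its
left. -/
theorem applyInside_cupRight {X Y W Z Z' : C} [ExactPairing Z Z']
    (E : X ⊗ (W ⊗ Z) ⟶ Y ⊗ (W ⊗ Z)) :
    applyInside E (cupRight W Z Z') (R.capRight W Z Z') =
      R.ptr Z Z' ((α_ X W Z).hom ≫ E ≫ (α_ Y W Z).inv) := by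
  rw [applyInside, cupRight, capRight, ptr]; monoidal

theorem applyInside_cupLeft {X Y W Z Z' : C} [ExactPairing Z Z'] (E : X ⊗ Z ⟶ Y ⊗ Z) :
    applyInside E (cupLeft W Z Z') (R.capLeft W Z Z') = R.ptr Z Z' E ▷ W := by
  rw [applyInside, cupLeft, capLeft, ptr]; monoidal

end RibbonStructure

end Cups

variable [Preadditive C] [MonoidalPreadditive C]
  {k : Type w} [Field k] [Linear k C] [MonoidalLinear k C]

/-- `applyInside` is linear in its last argument. -/
def applyInsideₗ (k : Type w) [Field k] [Linear k C] [MonoidalLinear k C]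
    {X Y W Z Q : C} (E : X ⊗ Z ⟶ Y ⊗ Z) (p : W ⟶ Z ⊗ Q) :
    (Z ⊗ Q ⟶ W) →ₗ[k] (X ⊗ W ⟶ Y ⊗ W) where
  toFun q := applyInside E p q
  map_add' q q' := by simp [applyInside]
  map_smul' c q := by simp [applyInside]

variable [BraidedCategory C] [RigidCategory C] {R : RibbonStructure C}
  {I : Type*} {a : I → C} {d : I → k}

/-- The bent inclusions and projections of a decomposition of `W ⊗ a i` are dual to each other. -/
theorem bent_comp_bent (hd : ∀ i, R.tr (a i) ((a i)ᘁ) (𝟙 _) = d i • 𝟙 _) {W : C} {i j : I}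
    {ι : a j ⟶ W ⊗ a i} {π : W ⊗ a i ⟶ a j} {y : (a i)ᘁ ⟶ (a j)ᘁ ⊗ W} {z : (a j)ᘁ ⊗ W ⟶ (a i)ᘁ}
    (hy : a j ◁ y ≫ R.capLeft W (a j) ((a j)ᘁ) = ι ▷ (a i)ᘁ ≫ R.capRight W (a i) ((a i)ᘁ))
    (hz : cupLeft W (a j) ((a j)ᘁ) ≫ a j ◁ z = cupRight W (a i) ((a i)ᘁ) ≫ π ▷ (a i)ᘁ)
    (h1 : 𝟙 (𝟙_ C) ≠ 0) {c e : k} (hyz : y ≫ z = c • 𝟙 _) (hιπ : ι ≫ π = e • 𝟙 _) :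
    d i * c = d j * e := by
  have h₁ : R.tr (a j) ((a j)ᘁ) (ι ≫ π) = (d j * e) • 𝟙 _ := by
    have := hd j
    rw [RibbonStructure.tr] at this ⊢
    rw [hιπ, MonoidalLinear.smul_whiskerRight, Linear.smul_comp, Linear.comp_smul, this,
      smul_smul, mul_comm]
  have h₂ : R.tr ((a i)ᘁ) (((a i)ᘁ)ᘁ) (y ≫ z) = (d i * c) • 𝟙 _ := by
    have := hd i
    rw [RibbonStructure.tr] at this
    rw [RibbonStructure.tr_rightDual, hyz]
    rw [MonoidalLinear.whiskerLeft_smul, Linear.smul_comp, Linear.comp_smul, whiskerLeft_id,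
      ← id_whiskerRight, this, smul_smul, mul_comm]
  -- Written as iterated traces, both sides are one closed diagram; `hy` and `hz` straighten the
  -- bent strands.
  have h₃ : R.tr ((a i)ᘁ) (((a i)ᘁ)ᘁ) (y ≫ z) = R.tr (a j) ((a j)ᘁ) (ι ≫ π) := by
    rw [R.tr_comp_eq_tr_ptr (X' := ((a j)ᘁ)ᘁ) (Y' := Wᘁ) y z, R.tr_rightDual,
      R.coevaluation_comp_ptr_comp_ev, R.tr_comp_eq_tr_ptr (X' := Wᘁ) (Y' := (a i)ᘁ) ι π,
      R.ptr_eq_cup_cap, comp_whiskerRight, Category.assoc, ← hy, ← reassoc_of% hz]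
    congr 1
    simp [cupLeft, RibbonStructure.capLeft]
  rw [h₂, h₁] at h₃
  exact smul_left_injective k h1 h₃

/-- Up to the factor in `bent_comp_bent`, the bent projections and inclusions are dual bases. As `i`
varies, the `y i r` exhaust the morphisms from simples into `(a j)ᘁ ⊗ W`, so the identity may be
tested on them. The relation `d i * c = d j * e` suffices without dividing by any `d i`. -/
theorem sum_bent_comp_bent [Fintype I] (ha : IsSimpleBasis k a) (h1 : 𝟙 (𝟙_ C) ≠ 0)
    (hd : ∀ i, R.tr (a i) ((a i)ᘁ) (𝟙 _) = d i • 𝟙 _) {W : C} (j : I)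
    (D : ∀ i, IsotypicDecomposition a (W ⊗ a i))
    {y : ∀ i, Fin ((D i).mult j) → ((a i)ᘁ ⟶ (a j)ᘁ ⊗ W)}
    {z : ∀ i, Fin ((D i).mult j) → ((a j)ᘁ ⊗ W ⟶ (a i)ᘁ)}
    (hy : ∀ i r, a j ◁ y i r ≫ R.capLeft W (a j) ((a j)ᘁ) =
      (D i).ι j r ▷ (a i)ᘁ ≫ R.capRight W (a i) ((a i)ᘁ))
    (hz : ∀ i r, cupLeft W (a j) ((a j)ᘁ) ≫ a j ◁ z i r =
      cupRight W (a i) ((a i)ᘁ) ≫ (D i).π j r ▷ (a i)ᘁ) :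
    ∑ i, d i • ∑ r, z i r ≫ y i r = d j • 𝟙 ((a j)ᘁ ⊗ W) := by
  refine ha.rightDual.hom_ext fun i (t : (a i)ᘁ ⟶ _) => ?_
  obtain ⟨s, hs⟩ := R.exists_capRight (X := a i) (X' := (a i)ᘁ) (T := a j)
    (a j ◁ t ≫ R.capLeft W (a j) ((a j)ᘁ))
  obtain ⟨c, rfl⟩ := ha.exists_eq_sum_ι (D i) s
  have ht : (t : (a i)ᘁ ⟶ _) = ∑ r, c r • y i r := by
    apply R.whiskerLeft_comp_capLeft_injective (X := a j) (X' := (a j)ᘁ)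
    rw [← hs, sum_whiskerRight, Preadditive.sum_comp, whiskerLeft_sum, Preadditive.sum_comp]
    simp [hy]
  rw [ht]
  simp only [Preadditive.sum_comp, Linear.smul_comp]
  refine Finset.sum_congr rfl fun r _ => ?_
  congr 1
  simp only [Preadditive.comp_sum, Linear.comp_smul, Category.comp_id]
  rw [Finset.sum_eq_single i]
  · rw [Finset.smul_sum, Finset.sum_eq_single r]
    · obtain ⟨c', hc'⟩ := ha.rightDual.exists_eq_smul (y i r ≫ z i r)
      have := bent_comp_bent hd (hy i r) (hz i r) h1 hc' (e := 1) (by rw [(D i).ι_π_self, one_smul])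
      rw [← Category.assoc, hc', Linear.smul_comp, smul_smul, this, mul_one, Category.id_comp]
    · intro s _ hs
      obtain ⟨c', hc'⟩ := ha.rightDual.exists_eq_smul (y i r ≫ z i s)
      have := bent_comp_bent hd (hy i r) (hz i s) h1 hc' (e := 0)
        (by rw [(D i).ι_π_ne j hs.symm, zero_smul])
      rw [← Category.assoc, hc', Linear.smul_comp, smul_smul, this, mul_zero, zero_smul]
    · simp
  · intro l _ hl
    rw [Finset.sum_eq_zero, smul_zero]
    intro s _
    rw [← Category.assoc, ha.rightDual.hom_eq_zero hl.symm (y i r ≫ z l s), zero_comp]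
  · simp

/-- The weighted sum over the simple objects has the killing property: it absorbs objects. -/
theorem sum_ptr_tensor_eq_sum_ptr_whiskerRight [Fintype I] (ha : IsSimpleBasis k a)
    (h1 : 𝟙 (𝟙_ C) ≠ 0) (hd : ∀ i, R.tr (a i) ((a i)ᘁ) (𝟙 _) = d i • 𝟙 _) {X Y : C} (E : ∀ Z, X ⊗ Z ⟶ Y ⊗ Z)
    (hE : ∀ {Z Z' : C} (f : Z ⟶ Z'), X ◁ f ≫ E Z' = E Z ≫ Y ◁ f) (W : C) :
    ∑ i, d i • R.ptr (a i) ((a i)ᘁ) ((α_ X W (a i)).hom ≫ E (W ⊗ a i) ≫ (α_ Y W (a i)).inv) =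
      ∑ j, d j • R.ptr (a j) ((a j)ᘁ) (E (a j)) ▷ W := by
  have D := fun i => (ha.exists_isotypicDecomposition (W ⊗ a i)).some
  choose y hy using fun i j r => R.exists_whiskerLeft_comp_capLeft (X := a j) (X' := (a j)ᘁ)
    ((D i).ι j r ▷ (a i)ᘁ ≫ R.capRight W (a i) ((a i)ᘁ))
  choose z hz using fun i j r => exists_cupLeft_comp_whiskerLeft (X := a j) (X' := (a j)ᘁ)
    (cupRight W (a i) ((a i)ᘁ) ≫ (D i).π j r ▷ (a i)ᘁ)
  -- Inserting the decomposition of `W ⊗ a i` and moving each projection through `E` replaces `E (W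
  -- ⊗ a i)` by the `E (a j)`. After bending, the sum over `i` only involves `z ≫ y`.
  have hL : ∀ i, applyInside (E (W ⊗ a i)) (cupRight W (a i) ((a i)ᘁ))
      (R.capRight W (a i) ((a i)ᘁ)) = ∑ j, ∑ r, applyInsideₗ k (E (a j))
        (cupLeft W (a j) ((a j)ᘁ)) (a j ◁ (z i j r ≫ y i j r) ≫ R.capLeft W (a j) ((a j)ᘁ)) := by
    intro i
    have h : R.capRight W (a i) ((a i)ᘁ) = ∑ j, ∑ r, (D i).π j r ▷ (a i)ᘁ ≫
        a j ◁ y i j r ≫ R.capLeft W (a j) ((a j)ᘁ) := by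
      simp only [hy, ← comp_whiskerRight_assoc]
      simp only [← Preadditive.sum_comp, ← sum_whiskerRight, (D i).total]
      simp
    change applyInsideₗ k _ _ _ = _
    rw [h]
    simp only [map_sum]
    refine Finset.sum_congr rfl fun j _ => Finset.sum_congr rfl fun r _ => ?_
    change applyInside _ _ _ = applyInside _ _ _
    rw [← applyInside_whiskerRight _ _ _ (hE _), ← hz, applyInside_whiskerLeft]
    simp
  simp only [← R.applyInside_cupRight, ← R.applyInside_cupLeft, hL]
  simp only [Finset.smul_sum]
  rw [Finset.sum_comm]
  refine Finset.sum_congr rfl fun j _ => ?_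
  have h := sum_bent_comp_bent ha h1 hd j D (fun i r => hy i j r) (fun i r => hz i j r)
  change _ = d j • applyInsideₗ k _ _ _
  simp only [← map_smul, ← map_sum]
  congr 1
  have h' := congrArg (fun x => a j ◁ x ≫ R.capLeft W (a j) ((a j)ᘁ)) h
  simpa [whiskerLeft_sum, Preadditive.sum_comp, Finset.smul_sum] using h'

end Killing

/-! ### The global dimension is nonzero -/

section GlobalDimension

/-- If the matrices `N l` with nonnegative combination the identity and their transposes have `d` as
a common eigenvector with the same eigenvalues `d l`, then the sum of the squares of the entries
of `d` does not vanish. -/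
theorem sum_sq_ne_zero_of_mulVec_eq {I k : Type*} [Fintype I] [DecidableEq I] [Field k] [CharZero k]
    (N : I → Matrix I I ℤ) (d : I → k) (hd : d ≠ 0) (i₀ : I) (h₀ : N i₀ = 1)
    (h : ∀ l, ((N l).map (Int.cast : ℤ → k)).mulVec d = d l • d)
    (h' : ∀ l, ((N l).transpose.map (Int.cast : ℤ → k)).mulVec d = d l • d) :
    ∑ l, d l * d l ≠ 0 := by
  intro h0
  let M : Matrix I I ℤ := ∑ l, N l * (N l).transpose
  have hM : (M.map (Int.castRingHom k)).mulVec d = 0 := by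
    have : M.map (Int.castRingHom k) = ∑ l, (N l).map (Int.castRingHom k) *
        (N l).transpose.map (Int.castRingHom k) := by
      simp only [M, ← RingHom.mapMatrix_apply, map_sum, map_mul]
    rw [this, Matrix.sum_mulVec]
    have hl : ∀ l, ((N l).map (Int.castRingHom k) *
        (N l).transpose.map (Int.castRingHom k)).mulVec d = (d l * d l) • d := fun l => by
      rw [← Matrix.mulVec_mulVec]
      erw [h' l]
      rw [Matrix.mulVec_smul]
      erw [h l]
      rw [smul_smul]
    simp only [hl, ← Finset.sum_smul, h0, zero_smul]
  -- If the sum of squares vanished, `d` would be in the kernel of `M = ∑ N l * (N l)ᵀ`. In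
  -- characteristic `0` the integer determinant then vanishes too, so `M` has a nonzero integer
  -- kernel vector, where positivity is available.
  have hdet : M.det = 0 := by
    have := Matrix.exists_mulVec_eq_zero_iff.1 ⟨d, hd, hM⟩
    rw [← RingHom.mapMatrix_apply, ← RingHom.map_det] at this
    simpa using this
  obtain ⟨x, hx, hMx⟩ := Matrix.exists_mulVec_eq_zero_iff.2 hdet
  refine hx ?_
  have hs : ∑ l, (N l).transpose.mulVec x ⬝ᵥ (N l).transpose.mulVec x = 0 := by
    have h₁ : x ⬝ᵥ M.mulVec x = 0 := by rw [hMx, dotProduct_zero]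
    rw [Matrix.sum_mulVec, dotProduct_sum] at h₁
    rw [← h₁]
    refine Finset.sum_congr rfl fun l _ => ?_
    rw [← Matrix.mulVec_mulVec, Matrix.mulVec_transpose, Matrix.dotProduct_mulVec x (N l)]
  have hnn : ∀ y : I → ℤ, 0 ≤ y ⬝ᵥ y := fun y => Finset.sum_nonneg fun i _ => mul_self_nonneg _
  have h₂ := (Finset.sum_eq_zero_iff_of_nonneg fun l _ => hnn _).1 hs i₀ (Finset.mem_univ _)
  rw [h₀, Matrix.transpose_one, Matrix.one_mulVec, dotProduct_self_eq_zero] at h₂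
  exact h₂

/-! ### The dimensions as a common eigenvector of the fusion matrices. -/

open RibbonStructure

variable {C : Type u} [Category.{v} C] [MonoidalCategory C] [Preadditive C] [MonoidalPreadditive C]
  {k : Type w} [Field k] [Linear k C] [MonoidalLinear k C]
  {I : Type*} [Fintype I] {a : I → C}

/-- Bending identifies Hom spaces. -/
theorem finrank_hom_tensor_left {X X' Y Z : C} [ExactPairing X' X] :
    Module.finrank k (X ⊗ Y ⟶ Z) = Module.finrank k (Y ⟶ X' ⊗ Z) :=
  LinearEquiv.finrank_eq
    { tensorLeftHomEquiv Y X' X Z with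
      map_add' := fun f g => by simp [tensorLeftHomEquiv]
      map_smul' := fun c f => by simp [tensorLeftHomEquiv] }

/-- The unit object is isomorphic to one of the simple objects. -/
theorem IsSimpleBasis.exists_iso_unit {C : Type u} [Category.{v} C] [MonoidalCategory C]
    [Preadditive C] [Linear k C] {a : I → C} (ha : IsSimpleBasis k a) (h1 : 𝟙 (𝟙_ C) ≠ 0)
    (hk : ∀ f : 𝟙_ C ⟶ 𝟙_ C, ∃ c : k, f = c • 𝟙 _) : ∃ i, Nonempty (a i ≅ 𝟙_ C) := by
  obtain ⟨D⟩ := ha.exists_isotypicDecomposition (𝟙_ C)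
  have : ∃ i, ∃ r : Fin (D.mult i), D.π i r ≫ D.ι i r ≠ 0 := by
    by_contra! h
    exact h1 (by rw [← D.total]; simp [h])
  obtain ⟨i, r, hr⟩ := this
  obtain ⟨c, hc⟩ := hk (D.π i r ≫ D.ι i r)
  have hc1 : c * c = c := by
    have h₂ : (D.π i r ≫ D.ι i r) ≫ D.π i r ≫ D.ι i r = D.π i r ≫ D.ι i r := by
      simp [reassoc_of% D.ι_π_self i r]
    rw [hc, Linear.smul_comp, Linear.comp_smul, Category.comp_id, smul_smul] at h₂
    exact smul_left_injective k h1 h₂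
  have hc0 : c ≠ 0 := by
    rintro rfl
    exact hr (by rw [hc, zero_smul])
  have : c = 1 := by simpa [hc0] using hc1
  exact ⟨i, ⟨⟨D.ι i r, D.π i r, D.ι_π_self i r, by rw [hc, this, one_smul]⟩⟩⟩

variable [BraidedCategory C] [RigidCategory C] {R : RibbonStructure C} {d : I → k}

/-- The trace of the identity of `W ⊗ a j` is computed both as an iterated trace and summand by
summand. -/
theorem dim_mul_dim (ha : IsSimpleBasis k a) (h1 : 𝟙 (𝟙_ C) ≠ 0)
    (hd : ∀ i, R.tr (a i) ((a i)ᘁ) (𝟙 _) = d i • 𝟙 _) {W : C} {c : k}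
    (hW : R.tr W (Wᘁ) (𝟙 _) = c • 𝟙 _) (j : I) :
    ∑ i, (Module.finrank k (a i ⟶ W ⊗ a j) : k) * d i = c * d j := by
  obtain ⟨D⟩ := ha.exists_isotypicDecomposition (W ⊗ a j)
  have h₁ : R.ptr (a j) ((a j)ᘁ) (𝟙 (W ⊗ a j)) = d j • 𝟙 W := by
    have h := congrArg (fun f => (ρ_ W).inv ≫ W ◁ f ≫ (ρ_ W).hom) (hd j)
    rw [tr] at h
    rw [ptr]
    simpa using h
  have h₂ : R.tr W (Wᘁ) (R.ptr (a j) ((a j)ᘁ) (𝟙 (W ⊗ a j))) = (c * d j) • 𝟙 _ := by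
    rw [tr] at hW
    rw [h₁, tr, MonoidalLinear.smul_whiskerRight, Linear.smul_comp, Linear.comp_smul, hW,
      smul_smul, mul_comm]
  have h₃ : R.tr W (Wᘁ) (R.ptr (a j) ((a j)ᘁ) (𝟙 (W ⊗ a j))) =
      ∑ i, ∑ r, R.tr W (Wᘁ) (R.ptr (a j) ((a j)ᘁ) (D.π i r ≫ D.ι i r)) := by
    rw [← D.total]
    simp only [tr, ptr, sum_whiskerRight, Preadditive.sum_comp, Preadditive.comp_sum]
  rw [h₃] at h₂
  have h₄ : ∀ i r, R.tr W (Wᘁ) (R.ptr (a j) ((a j)ᘁ) (D.π i r ≫ D.ι i r)) = d i • 𝟙 _ :=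
    fun i r => by rw [← R.tr_comp_eq_tr_ptr (Z' := (a i)ᘁ), D.ι_π_self, hd]
  simp only [h₄, ← Finset.sum_smul] at h₂
  rw [← smul_left_injective k h1 h₂]
  refine Finset.sum_congr rfl fun i _ => ?_
  rw [ha.finrank_hom_from D i]
  simp

theorem sum_dim_sq_ne_zero [CharZero k] (ha : IsSimpleBasis k a) (h1 : 𝟙 (𝟙_ C) ≠ 0)
    (hk : ∀ f : 𝟙_ C ⟶ 𝟙_ C, ∃ c : k, f = c • 𝟙 _)
    (hd : ∀ i, R.tr (a i) ((a i)ᘁ) (𝟙 _) = d i • 𝟙 _) : ∑ i, d i * d i ≠ 0 := by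
  classical
  obtain ⟨i₀, ⟨e⟩⟩ := ha.exists_iso_unit h1 hk
  refine sum_sq_ne_zero_of_mulVec_eq
    (fun l => Matrix.of fun j i => (Module.finrank k (a i ⟶ a l ⊗ a j) : ℤ)) d ?_ i₀ ?_ ?_ ?_
  · intro hd0
    have h := hd i₀
    rw [hd0, Pi.zero_apply, zero_smul, ← e.hom_inv_id,
      R.tr_comp_comm (X' := (a i₀)ᘁ) (Y' := 𝟙_ C) e.hom e.inv, e.inv_hom_id] at h
    have hη : IsIso (η_ (𝟙_ C) (𝟙_ C)) := inferInstanceAs (IsIso (ρ_ (𝟙_ C)).inv)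
    have hε : IsIso (ε_ (𝟙_ C) (𝟙_ C)) := inferInstanceAs (IsIso (ρ_ (𝟙_ C)).hom)
    have hθ : IsIso (R.θ (𝟙_ C)) := inferInstanceAs (IsIso (R.twist.hom.app (𝟙_ C)))
    have ht : IsIso (R.tr (𝟙_ C) (𝟙_ C) (𝟙 _)) := by
      rw [tr, ev]; infer_instance
    rw [h] at ht
    exact h1 (by rw [← IsIso.hom_inv_id (0 : 𝟙_ C ⟶ 𝟙_ C), zero_comp])
  · ext j i
    rw [Matrix.of_apply]
    have h₁ : Module.finrank k (a i ⟶ a i₀ ⊗ a j) = Module.finrank k (a i ⟶ a j) :=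
      LinearEquiv.finrank_eq (Linear.homCongr k (Iso.refl _)
        (whiskerRightIso e (a j) ≪≫ λ_ (a j)))
    rw [h₁, Matrix.one_apply]
    split_ifs with hij
    · subst hij
      have : Module.finrank k (a j ⟶ a j) = 1 :=
        finrank_eq_one (𝟙 _) (ha.id_ne_zero j) fun f =>
          (ha.exists_eq_smul f).imp fun c hc => hc.symm
      simp [this]
    · have : Subsingleton (a i ⟶ a j) :=
        ⟨fun f g => by rw [ha.hom_eq_zero (Ne.symm hij) f, ha.hom_eq_zero (Ne.symm hij) g]⟩
      simp [Module.finrank_zero_of_subsingleton]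
  · intro l
    ext j
    have := dim_mul_dim ha h1 hd (hd l) j
    simpa [Matrix.mulVec, dotProduct] using this
  · intro l
    ext j
    -- The transposed fusion matrix belongs to tensoring with the dual of `a l`, which has the same
    -- dimension.
    have hl : R.tr ((a l)ᘁ) (((a l)ᘁ)ᘁ) (𝟙 _) = d l • 𝟙 _ := by
      rw [tr_rightDual, ← hd l, tr]; simp
    have := dim_mul_dim ha h1 hd hl j
    have h₂ : ∀ i, Module.finrank k (a j ⟶ a l ⊗ a i) = Module.finrank k (a i ⟶ (a l)ᘁ ⊗ a j) := by
      intro i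
      obtain ⟨D⟩ := ha.exists_isotypicDecomposition (a l ⊗ a i)
      let _ := R.exactPairingSymm (a l) ((a l)ᘁ)
      rw [ha.finrank_hom_from D j, ← ha.finrank_hom_to D j, finrank_hom_tensor_left (X' := (a l)ᘁ)]
    simpa [Matrix.mulVec, dotProduct, h₂] using this

end GlobalDimension

/-! ### Averaging over a half-braiding -/

section Averaging

variable {C : Type u} [Category.{v} C] [MonoidalCategory C]

namespace CategoryTheory.HalfBraiding

/-- Naturality for `𝟙_ C ⊗ 𝟙_ C ≅ 𝟙_ C`, combined with multiplicativity, allows one copy of `γ.β (𝟙_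
C)` to be cancelled; what remains is a coherence isomorphism. -/
theorem β_unit {X : C} (γ : HalfBraiding X) : (γ.β (𝟙_ C)).hom = (ρ_ X).hom ≫ (λ_ X).inv := by
  have h := γ.naturality (λ_ (𝟙_ C)).hom
  rw [γ.monoidal] at h
  have h₁ : X ◁ (λ_ (𝟙_ C)).hom = (α_ X (𝟙_ C) (𝟙_ C)).inv ≫ (γ.β (𝟙_ C)).hom ▷ 𝟙_ C ≫
      (α_ (𝟙_ C) X (𝟙_ C)).hom ≫ (λ_ (X ⊗ 𝟙_ C)).hom := by
    rw [← cancel_mono (γ.β (𝟙_ C)).hom, h]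
    simp
  have h₂ : (γ.β (𝟙_ C)).hom ▷ 𝟙_ C = (α_ X (𝟙_ C) (𝟙_ C)).hom ≫ X ◁ (λ_ (𝟙_ C)).hom ≫
      (λ_ (X ⊗ 𝟙_ C)).inv ≫ (α_ (𝟙_ C) X (𝟙_ C)).inv := by
    rw [h₁]; simp only [Category.assoc, Iso.hom_inv_id_assoc, Iso.hom_inv_id, Category.comp_id]
  calc
    _ = (ρ_ (X ⊗ 𝟙_ C)).inv ≫ (γ.β (𝟙_ C)).hom ▷ 𝟙_ C ≫ (ρ_ (𝟙_ C ⊗ X)).hom := by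
      rw [rightUnitor_naturality, Iso.inv_hom_id_assoc]
    _ = _ := by
      rw [h₂]; monoidal

/-- Compatibility of a morphism with half-braidings of its source and target. -/
def IsCompatible {X Y : C} (γ : HalfBraiding X) (δ : HalfBraiding Y) (f : X ⟶ Y) : Prop :=
  ∀ Z : C, Z ◁ f ≫ δ.cross Z = γ.cross Z ≫ f ▷ Z

theorem isCompatible_iff {X Y : C} {γ : HalfBraiding X} {δ : HalfBraiding Y} {f : X ⟶ Y} :
    IsCompatible γ δ f ↔ ∀ Z : C, f ▷ Z ≫ (δ.β Z).hom = (γ.β Z).hom ≫ Z ◁ f := by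
  refine forall_congr' fun Z => ?_
  rw [cross, cross, Iso.comp_inv_eq, Category.assoc, Iso.eq_inv_comp, eq_comm]

section Braided

variable [BraidedCategory C]

/-- The half-braiding given by the braiding. -/
def ofBraiding (X : C) : HalfBraiding X where
  β U := β_ X U
  monoidal U U' := by rw [BraidedCategory.braiding_tensor_right_hom]
  naturality f := BraidedCategory.braiding_naturality_right X f

/-- The half-braiding given by the inverse of the braiding. -/
def ofBraidingInv (X : C) : HalfBraiding X where
  β U := (β_ U X).symm
  monoidal U U' := by simp [BraidedCategory.braiding_tensor_left_inv]
  naturality f := by simp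

variable [RigidCategory C] (R : RibbonStructure C)

/-- Conjugation of a morphism by half-braidings. -/
def conj {X Y : C} (γ : HalfBraiding X) (δ : HalfBraiding Y) (f : X ⟶ Y) (Z : C) :
    X ⊗ Z ⟶ Y ⊗ Z :=
  (γ.β Z).hom ≫ Z ◁ f ≫ (δ.β Z).inv

variable {X Y : C} {γ : HalfBraiding X} {δ : HalfBraiding Y}

omit [BraidedCategory C] [RigidCategory C] in
theorem conj_naturality (f : X ⟶ Y) {Z Z' : C} (g : Z ⟶ Z') :
    X ◁ g ≫ conj γ δ f Z' = conj γ δ f Z ≫ Y ◁ g := by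
  rw [conj, conj, γ.naturality_assoc, ← whisker_exchange_assoc]
  simp only [Category.assoc]
  have h : g ▷ Y ≫ (δ.β Z').inv = (δ.β Z).inv ≫ Y ◁ g := by
    rw [Iso.comp_inv_eq, Category.assoc, δ.naturality, Iso.inv_hom_id_assoc]
  rw [h]

end Braided

end CategoryTheory.HalfBraiding

namespace RibbonStructure

variable [BraidedCategory C] [RigidCategory C] (R : RibbonStructure C)

theorem ptr_whiskerRight_comp {X Y Z T V V' : C} [ExactPairing V V'] (g : X ⟶ Y)
    (f : Y ⊗ V ⟶ Z ⊗ V) (h : Z ⟶ T) :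
    R.ptr V V' (g ▷ V ≫ f ≫ h ▷ V) = g ≫ R.ptr V V' f ≫ h := by
  rw [ptr, ptr]
  calc
    _ = 𝟙 _ ⊗≫ (X ◁ η_ V V' ≫ g ▷ (V ⊗ V')) ⊗≫ f ▷ V' ⊗≫
        (h ▷ (V ⊗ V') ≫ T ◁ R.ev V V') ⊗≫ 𝟙 _ := by monoidal
    _ = 𝟙 _ ⊗≫ (g ▷ 𝟙_ C ≫ Y ◁ η_ V V') ⊗≫ f ▷ V' ⊗≫
        (Z ◁ R.ev V V' ≫ h ▷ 𝟙_ C) ⊗≫ 𝟙 _ := by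
      rw [whisker_exchange, ← whisker_exchange h]
    _ = _ := by monoidal

theorem ptr_whiskerLeft {X Y V V' : C} [ExactPairing V V'] (W : C) (f : X ⊗ V ⟶ Y ⊗ V) :
    R.ptr V V' ((α_ W X V).hom ≫ W ◁ f ≫ (α_ W Y V).inv) = W ◁ R.ptr V V' f := by
  rw [ptr, ptr]; monoidal

/-- A half-braided object can be moved through the loop of a partial trace. -/
theorem whiskerLeft_ptr_comp {X Y W V V' : C} [ExactPairing V V'] {f : X ⊗ V ⟶ Y ⊗ V}
    {a : W ⊗ X ⟶ X ⊗ W} {b : W ⊗ Y ⟶ Y ⊗ W} (d : HalfBraiding W)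
    (h : W ◁ f ≫ (α_ W Y V).inv ≫ b ▷ V ≫ (α_ Y W V).hom ≫ Y ◁ (d.β V).hom =
      (α_ W X V).inv ≫ a ▷ V ≫ (α_ X W V).hom ≫ X ◁ (d.β V).hom ≫ (α_ X V W).inv ≫ f ▷ W ≫
        (α_ Y V W).hom) :
    W ◁ R.ptr V V' f ≫ b = a ≫ R.ptr V V' f ▷ W := by
  -- The half-braiding of `W` is natural with respect to the cup and the cap of the loop, so `W` can
  -- cross both ends.
  have hη : W ◁ η_ V V' ≫ (α_ W V V').inv ≫ (d.β V).hom ▷ V' ≫ (α_ V W V').hom ≫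
      V ◁ (d.β V').hom ≫ (α_ V V' W).inv = (ρ_ W).hom ≫ (λ_ W).inv ≫ η_ V V' ▷ W := by
    rw [← d.monoidal, d.naturality, d.β_unit, Category.assoc]
  have hε : W ◁ R.ev V V' = ((α_ W V V').inv ≫ (d.β V).hom ▷ V' ≫ (α_ V W V').hom ≫
      V ◁ (d.β V').hom ≫ (α_ V V' W).inv) ≫ R.ev V V' ▷ W ≫ (λ_ W).hom ≫ (ρ_ W).inv := by
    rw [← d.monoidal, ← d.naturality_assoc, d.β_unit]; simp
  calc
    _ = 𝟙 _ ⊗≫ W ◁ X ◁ η_ V V' ⊗≫ W ◁ f ▷ V' ⊗≫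
        ((W ⊗ Y) ◁ R.ev V V' ≫ b ▷ 𝟙_ C) ⊗≫ 𝟙 _ := by rw [ptr]; monoidal
    _ = 𝟙 _ ⊗≫ W ◁ X ◁ η_ V V' ⊗≫ (W ◁ f ≫ (α_ W Y V).inv ≫ b ▷ V ≫ (α_ Y W V).hom ≫
        Y ◁ (d.β V).hom) ▷ V' ⊗≫ Y ◁ V ◁ (d.β V').hom ⊗≫ Y ◁ R.ev V V' ▷ W ⊗≫ 𝟙 _ := by
      rw [whisker_exchange]
      have : (Y ⊗ W) ◁ R.ev V V' = 𝟙 _ ⊗≫ Y ◁ W ◁ R.ev V V' ⊗≫ 𝟙 _ := by monoidal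
      rw [this, hε]; monoidal
    _ = 𝟙 _ ⊗≫ ((W ⊗ X) ◁ η_ V V' ≫ a ▷ (V ⊗ V')) ⊗≫ X ◁ (d.β V).hom ▷ V' ⊗≫
        (f ▷ (W ⊗ V') ≫ (Y ⊗ V) ◁ (d.β V').hom) ⊗≫ Y ◁ R.ev V V' ▷ W ⊗≫ 𝟙 _ := by
      rw [h]; monoidal
    _ = a ⊗≫ X ◁ (W ◁ η_ V V' ≫ (α_ W V V').inv ≫ (d.β V).hom ▷ V' ≫ (α_ V W V').hom ≫
        V ◁ (d.β V').hom ≫ (α_ V V' W).inv) ⊗≫ f ▷ V' ▷ W ⊗≫ Y ◁ R.ev V V' ▷ W ⊗≫ 𝟙 _ := by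
      rw [whisker_exchange, ← whisker_exchange f]; monoidal
    _ = _ := by
      rw [hη, ptr]; monoidal

end RibbonStructure

namespace CategoryTheory.HalfBraiding

variable [BraidedCategory C] [RigidCategory C] {R : RibbonStructure C}
variable {X Y : C} {γ : HalfBraiding X} {δ : HalfBraiding Y}

omit [RigidCategory C] in
theorem _root_.ExchangeRelation.whiskerLeft_comp {W Z : C} {a : W ⊗ X ⟶ X ⊗ W}
    {b : Z ⊗ X ⟶ X ⊗ Z} {d : W ⊗ Z ⟶ Z ⊗ W} (h : ExchangeRelation a b d) :
    W ◁ b ≫ (α_ W X Z).inv ≫ a ▷ Z ≫ (α_ X W Z).hom ≫ X ◁ d =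
      (α_ W Z X).inv ≫ (β_ W Z).hom ▷ X ≫ (α_ Z W X).hom ≫ Z ◁ a ≫ (α_ Z X W).inv ≫ b ▷ W ≫
        (α_ X Z W).hom := by
  rw [ExchangeRelation] at h
  rw [reassoc_of% h]
  simp

-- After precomposition with the invertible `γ.cross Z`, the conjugate becomes `f` followed by
-- `δ.cross Z`. The exchange relation on `Y`, the compatibility of `f` and the exchange relation on
-- `X` then apply in turn. As `d` is arbitrary, all three relations are covered.
omit [RigidCategory C] in
theorem whiskerLeft_conj {f : X ⟶ Y} {W Z : C} {a : W ⊗ X ⟶ X ⊗ W} {b : W ⊗ Y ⟶ Y ⊗ W}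
    {d : W ⊗ Z ⟶ Z ⊗ W} (hX : ExchangeRelation a (γ.cross Z) d)
    (hY : ExchangeRelation b (δ.cross Z) d) (hf : W ◁ f ≫ b = a ≫ f ▷ W) :
    W ◁ conj γ δ f Z ≫ (α_ W Y Z).inv ≫ b ▷ Z ≫ (α_ Y W Z).hom ≫ Y ◁ d =
      (α_ W X Z).inv ≫ a ▷ Z ≫ (α_ X W Z).hom ≫ X ◁ d ≫ (α_ X Z W).inv ≫ conj γ δ f Z ▷ W ≫
        (α_ Y Z W).hom := by
  have hc : γ.cross Z ≫ conj γ δ f Z = Z ◁ f ≫ δ.cross Z := by simp [conj, cross]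
  have hγ : IsIso (γ.cross Z) := inferInstanceAs (IsIso (γ.β Z).inv)
  rw [← cancel_epi (W ◁ γ.cross Z)]
  calc
    _ = W ◁ (γ.cross Z ≫ conj γ δ f Z) ≫ (α_ W Y Z).inv ≫ b ▷ Z ≫ (α_ Y W Z).hom ≫ Y ◁ d := by
      simp
    _ = W ◁ Z ◁ f ≫ (α_ W Z Y).inv ≫ (β_ W Z).hom ▷ Y ≫ (α_ Z W Y).hom ≫ Z ◁ b ≫
        (α_ Z Y W).inv ≫ δ.cross Z ▷ W ≫ (α_ Y Z W).hom := by
      rw [hc, MonoidalCategory.whiskerLeft_comp, Category.assoc, hY.whiskerLeft_comp]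
    _ = (α_ W Z X).inv ≫ ((W ⊗ Z) ◁ f ≫ (β_ W Z).hom ▷ Y) ≫ (α_ Z W Y).hom ≫ Z ◁ b ≫
        (α_ Z Y W).inv ≫ δ.cross Z ▷ W ≫ (α_ Y Z W).hom := by
      simp
    _ = (α_ W Z X).inv ≫ (β_ W Z).hom ▷ X ≫ (α_ Z W X).hom ≫ Z ◁ (W ◁ f ≫ b) ≫
        (α_ Z Y W).inv ≫ δ.cross Z ▷ W ≫ (α_ Y Z W).hom := by
      rw [whisker_exchange]; simp
    _ = (α_ W Z X).inv ≫ (β_ W Z).hom ▷ X ≫ (α_ Z W X).hom ≫ Z ◁ a ≫ (α_ Z X W).inv ≫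
        (γ.cross Z ≫ conj γ δ f Z) ▷ W ≫ (α_ Y Z W).hom := by
      rw [hf, hc]; simp
    _ = _ := by
      rw [reassoc_of% hX.whiskerLeft_comp]; simp

/-- The partial trace of a conjugate by the second half-braiding of a commuting pair is compatible
with the first one. -/
theorem isCompatible_ptr_conj {γ₁ γ₂ : HalfBraiding X} {δ₁ δ₂ : HalfBraiding Y} {f : X ⟶ Y}
    (hf : IsCompatible γ₁ δ₁ f)
    (h : (Comm1 γ₁ γ₂ ∧ Comm1 δ₁ δ₂) ∨ (Comm2 γ₁ γ₂ ∧ Comm2 δ₁ δ₂) ∨ (Comm3 γ₁ γ₂ ∧ Comm3 δ₁ δ₂))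
    (V V' : C) [ExactPairing V V'] :
    IsCompatible γ₁ δ₁ (R.ptr V V' (conj γ₂ δ₂ f V)) := by
  intro W
  rcases h with ⟨hγ, hδ⟩ | ⟨hγ, hδ⟩ | ⟨hγ, hδ⟩
  -- The first relation involves the crossing followed by a double braiding. The latter is natural
  -- and invertible, so it can be added before the loop is crossed and cancelled afterwards.
  · have hn : ∀ g : X ⟶ Y, (g ▷ W ≫ (β_ Y W).hom ≫ (β_ W Y).hom) =
        ((β_ X W).hom ≫ (β_ W X).hom) ≫ g ▷ W := fun g => by simp
    have hf' : W ◁ f ≫ δ₁.cross W ≫ (β_ Y W).hom ≫ (β_ W Y).hom =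
        (γ₁.cross W ≫ (β_ X W).hom ≫ (β_ W X).hom) ≫ f ▷ W := by
      rw [reassoc_of% hf W, hn]; simp only [Category.assoc]
    have := R.whiskerLeft_ptr_comp (V' := V') (ofBraiding W)
      (whiskerLeft_conj (hγ W V) (hδ W V) hf')
    rw [← cancel_mono ((β_ Y W).hom ≫ (β_ W Y).hom), Category.assoc, this]
    simp only [Category.assoc, hn]
  -- The inverse braiding in the second relation makes `W` cross the loop on its other side.
  · exact R.whiskerLeft_ptr_comp (V' := V') (ofBraidingInv W)
      (whiskerLeft_conj (hγ W V) (hδ W V) (hf W))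
  · exact R.whiskerLeft_ptr_comp (V' := V') (ofBraiding W)
      (whiskerLeft_conj (hγ W V) (hδ W V) (hf W))

/-- Conjugation by `W ⊗ V` is conjugation by `V` followed by conjugation by `W`, and the latter
comes out of the partial trace. -/
theorem ptr_conj_tensor (f : X ⟶ Y) (W V V' : C) [ExactPairing V V'] :
    R.ptr V V' ((α_ X W V).hom ≫ conj γ δ f (W ⊗ V) ≫ (α_ Y W V).inv) =
      (γ.β W).hom ≫ W ◁ R.ptr V V' (conj γ δ f V) ≫ (δ.β W).inv := by
  have hδ : (δ.β (W ⊗ V)).inv = (α_ W V Y).hom ≫ W ◁ (δ.β V).inv ≫ (α_ W Y V).inv ≫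
      (δ.β W).inv ▷ V ≫ (α_ Y W V).hom := by
    rw [← cancel_epi (δ.β (W ⊗ V)).hom, Iso.hom_inv_id, δ.monoidal]; simp
  rw [← R.ptr_whiskerLeft, ← R.ptr_whiskerRight_comp, conj, conj, γ.monoidal, hδ]
  congr 1
  simp

variable [Preadditive C] [MonoidalPreadditive C]
  {k : Type w} [Field k] [Linear k C] [MonoidalLinear k C]

omit [BraidedCategory C] [RigidCategory C] in
theorem IsCompatible.smul {f : X ⟶ Y} (hf : IsCompatible γ δ f) (c : k) :
    IsCompatible γ δ (c • f) := fun Z => by simp [hf Z]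

omit [BraidedCategory C] [RigidCategory C] in
theorem IsCompatible.sum {J : Type*} [Fintype J] {f : J → (X ⟶ Y)}
    (hf : ∀ j, IsCompatible γ δ (f j)) : IsCompatible γ δ (∑ j, f j) := fun Z => by
  simp only [whiskerLeft_sum, sum_whiskerRight, Preadditive.sum_comp, Preadditive.comp_sum, hf _ Z]

/-- The weighted sum of the partial traces of conjugates over all simple objects is compatible with
the half-braidings. -/
theorem isCompatible_sum_ptr_conj {I : Type*} [Fintype I] {a : I → C} {d : I → k}
    (ha : IsSimpleBasis k a) (h1 : 𝟙 (𝟙_ C) ≠ 0)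
    (hd : ∀ i, R.tr (a i) ((a i)ᘁ) (𝟙 _) = d i • 𝟙 _) (f : X ⟶ Y) :
    IsCompatible γ δ (∑ i, d i • R.ptr (a i) ((a i)ᘁ) (conj γ δ f (a i))) := by
  rw [isCompatible_iff]
  intro W
  have h := sum_ptr_tensor_eq_sum_ptr_whiskerRight ha h1 hd (conj γ δ f)
    (fun g => conj_naturality f g) W
  rw [sum_whiskerRight]
  simp only [MonoidalLinear.smul_whiskerRight]
  -- The killing property replaces the loops over `a i` beside `W` by loops through which `W` runs
  -- as well. The inverse half-braiding that then appears cancels.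
  rw [← h]
  simp only [ptr_conj_tensor, Preadditive.sum_comp, Linear.smul_comp, Category.assoc,
    Iso.inv_hom_id, Category.comp_id, whiskerLeft_sum, MonoidalLinear.whiskerLeft_smul,
    Preadditive.comp_sum, Linear.comp_smul]

theorem ptr_conj_id (γ : HalfBraiding X) {V V' : C} [ExactPairing V V'] {c : k}
    (hc : R.tr V V' (𝟙 V) = c • 𝟙 _) : R.ptr V V' (conj γ γ (𝟙 X) V) = c • 𝟙 X := by
  have h := congrArg (fun f => (ρ_ X).inv ≫ X ◁ f ≫ (ρ_ X).hom) hc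
  rw [RibbonStructure.tr] at h
  rw [RibbonStructure.ptr]
  simpa [conj] using h

end CategoryTheory.HalfBraiding

end Averaging

/-! ### Averaging operators on the categorical center of higher genera -/

namespace AdmissibleGluing

variable {n : ℕ} (σ : AdmissibleGluing n)

theorem orbit_apply (i : Fin (2 * n)) : σ.orbit (σ.1 i) = σ.orbit i :=
  Quotient.sound (Equiv.Perm.sameCycle_apply_left.2 (Equiv.Perm.SameCycle.refl _ _))

theorem orbit_lower (i : Fin (2 * n)) : σ.orbit (σ.lower i) = σ.orbit i := by
  rcases min_choice i (σ.1 i) with h | h <;> rw [lower, h]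
  exact σ.orbit_apply i

theorem orbit_upper (i : Fin (2 * n)) : σ.orbit (σ.upper i) = σ.orbit i := by
  rcases max_choice i (σ.1 i) with h | h <;> rw [upper, h]
  exact σ.orbit_apply i

theorem lower_lt_upper (i : Fin (2 * n)) : σ.lower i < σ.upper i :=
  min_lt_max.2 (σ.2.1 i).symm

end AdmissibleGluing

namespace HigherCenter

variable {C : Type u} [Category.{v} C] [MonoidalCategory C] [BraidedCategory C] {n : ℕ}
  {σ : AdmissibleGluing n}

/-- The half-braidings of two different orbits commute in one of the three ways. -/
theorem comm_or {i j : Fin (2 * n)} (hij : σ.orbit i ≠ σ.orbit j) (h : σ.lower i < σ.lower j) :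
    (∀ A : HigherCenter C σ, Comm1 (A.γ (σ.orbit i)) (A.γ (σ.orbit j))) ∨
    (∀ A : HigherCenter C σ, Comm2 (A.γ (σ.orbit i)) (A.γ (σ.orbit j))) ∨
    (∀ A : HigherCenter C σ, Comm3 (A.γ (σ.orbit i)) (A.γ (σ.orbit j))) := by
  have h₁ : σ.upper i ≠ σ.lower j := fun e =>
    hij (by rw [← σ.orbit_upper, e, σ.orbit_lower])
  have h₂ : σ.upper i ≠ σ.upper j := fun e =>
    hij (by rw [← σ.orbit_upper, e, σ.orbit_upper])
  rcases lt_or_gt_of_ne h₁ with h₁ | h₁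
  · exact .inl fun A => A.comm1 i j (σ.lower_lt_upper i) h₁ (σ.lower_lt_upper j)
  · rcases lt_or_gt_of_ne h₂ with h₂ | h₂
    · exact .inr (.inl fun A => A.comm2 i j h h₁ h₂)
    · exact .inr (.inr fun A => A.comm3 i j h (σ.lower_lt_upper j) h₂)

variable [Preadditive C]

variable (C σ) in
/-- An operator turning the morphisms of `C` between objects of `Z_σ(C)` into morphisms compatible
with the half-braidings of the orbits of the first `m` elements. -/
structure AveragingOperator (m : ℕ) where
  Index : Type
  [fintype : Fintype Index]
  functor : Index → C ⥤ C
  additive : ∀ s, (functor s).Additive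
  unit : ∀ (A : HigherCenter C σ) s, A.X ⟶ (functor s).obj A.X
  counit : ∀ (A : HigherCenter C σ) s, (functor s).obj A.X ⟶ A.X
  unit_naturality : ∀ {A B : HigherCenter C σ} (p : A ⟶ B) s,
    unit A s ≫ (functor s).map p.f = p.f ≫ unit B s
  counit_naturality : ∀ {A B : HigherCenter C σ} (p : A ⟶ B) s,
    (functor s).map p.f ≫ counit B s = counit A s ≫ p.f
  sum_unit_counit : ∀ A : HigherCenter C σ, ∑ s, unit A s ≫ counit A s = 𝟙 A.X
  isCompatible : ∀ {A B : HigherCenter C σ} (f : A.X ⟶ B.X) (i : Fin (2 * n)), i.1 < m →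
    HalfBraiding.IsCompatible (A.γ (σ.orbit i)) (B.γ (σ.orbit i))
      (∑ s, unit A s ≫ (functor s).map f ≫ counit B s)

namespace AveragingOperator

attribute [instance] fintype additive

variable {m : ℕ} (P : AveragingOperator C σ m)

/-- The average of a morphism. -/
def average {A B : HigherCenter C σ} (f : A.X ⟶ B.X) : A.X ⟶ B.X :=
  ∑ s, P.unit A s ≫ (P.functor s).map f ≫ P.counit B s

theorem comp_average {A B D : HigherCenter C σ} (p : A ⟶ B) (f : B.X ⟶ D.X) :
    P.average (p.f ≫ f) = p.f ≫ P.average f := by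
  simp [average, Preadditive.comp_sum, ← reassoc_of% P.unit_naturality p]

theorem average_comp {A B D : HigherCenter C σ} (f : A.X ⟶ B.X) (p : B ⟶ D) :
    P.average (f ≫ p.f) = P.average f ≫ p.f := by
  simp [average, Preadditive.sum_comp, P.counit_naturality p]

theorem average_id (A : HigherCenter C σ) : P.average (𝟙 A.X) = 𝟙 A.X := by
  simp [average, P.sum_unit_counit]

/-- The identity operator. -/
def zero : AveragingOperator C σ 0 where
  Index := Unit
  functor _ := 𝟭 C
  additive _ := inferInstance
  unit A _ := 𝟙 A.X
  counit A _ := 𝟙 A.X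
  unit_naturality p _ := by simp
  counit_naturality p _ := by simp
  sum_unit_counit A := by simp
  isCompatible f i h := absurd h (Nat.not_lt_zero _)

/-- An averaging operator when the next element lies in the orbit of a previous one. -/
def succOfMem (j : Fin (2 * n)) (hj : j.1 = m) (i : Fin (2 * n)) (hi : i.1 < m)
    (h : σ.orbit i = σ.orbit j) : AveragingOperator C σ (m + 1) :=
  { P with
    isCompatible := fun f l hl => by
      rcases Nat.lt_succ_iff_lt_or_eq.1 hl with hl | hl
      · exact P.isCompatible f l hl
      · obtain rfl : l = j := Fin.ext (hl.trans hj.symm)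
        rw [← h]
        exact P.isCompatible f i hi }

variable [RigidCategory C] {R : RibbonStructure C} [MonoidalPreadditive C]
  {k : Type w} [Field k] [Linear k C] [MonoidalLinear k C]

omit [RigidCategory C] [Preadditive C] [MonoidalPreadditive C] [Linear k C] [MonoidalLinear k C] in
theorem β_comp_whiskerLeft {A B : HigherCenter C σ} (p : A ⟶ B) (o : σ.Orbit) (Z : C) :
    ((A.γ o).β Z).hom ≫ Z ◁ p.f = p.f ▷ Z ≫ ((B.γ o).β Z).hom :=
  (HalfBraiding.isCompatible_iff.1 (p.comm o) Z).symm

omit [RigidCategory C] [Preadditive C] [MonoidalPreadditive C] [Linear k C] [MonoidalLinear k C] in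
theorem whiskerLeft_comp_β_inv {A B : HigherCenter C σ} (p : A ⟶ B) (o : σ.Orbit) (Z : C) :
    Z ◁ p.f ≫ ((B.γ o).β Z).inv = ((A.γ o).β Z).inv ≫ p.f ▷ Z :=
  p.comm o Z

-- Identifies the unit-counit form of the composite operator with a weighted sum of partial traces,
-- so that the results on averaging one half-braiding apply to `succ`.
omit [MonoidalLinear k C] in
theorem sum_conj {N : ℕ} (a : Fin N → C) (c : Fin N → k) (o : σ.Orbit) {A B : HigherCenter C σ}
    (f : A.X ⟶ B.X) :
    ∑ s : Fin N × P.Index, (cupRight A.X (a s.1) ((a s.1)ᘁ) ≫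
      ((A.γ o).β (a s.1)).hom ▷ (a s.1)ᘁ ≫ (a s.1 ◁ P.unit A s.2) ▷ (a s.1)ᘁ) ≫
      (a s.1 ◁ (P.functor s.2).map f) ▷ (a s.1)ᘁ ≫
      (c s.1 • ((a s.1 ◁ P.counit B s.2) ▷ (a s.1)ᘁ ≫ ((B.γ o).β (a s.1)).inv ▷ (a s.1)ᘁ ≫
        R.capRight B.X (a s.1) ((a s.1)ᘁ))) =
    ∑ i, c i • R.ptr (a i) ((a i)ᘁ)
      (HalfBraiding.conj (A.γ o) (B.γ o) (P.average f) (a i)) := by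
  rw [Fintype.sum_prod_type]
  refine Finset.sum_congr rfl fun i _ => ?_
  simp only [Linear.comp_smul, ← Finset.smul_sum]
  congr 1
  rw [R.ptr_eq_cup_cap, HalfBraiding.conj, average]
  simp [whiskerLeft_sum, sum_whiskerRight, Preadditive.sum_comp, Preadditive.comp_sum]

/-- Compose an averaging operator with the average over one half-braiding. -/
noncomputable def succ {N : ℕ} {a : Fin N → C} {d : Fin N → k}
    (ha : IsSimpleBasis k a) (h1 : 𝟙 (𝟙_ C) ≠ 0)
    (hd : ∀ i, R.tr (a i) ((a i)ᘁ) (𝟙 _) = d i • 𝟙 _) (hd0 : ∑ i, d i * d i ≠ 0)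
    (j : Fin (2 * n)) (hj : j.1 = m) (h : ∀ i : Fin (2 * n), i.1 < m → σ.orbit i ≠ σ.orbit j) :
    AveragingOperator C σ (m + 1) where
  Index := Fin N × P.Index
  functor s := P.functor s.2 ⋙ tensorLeft (a s.1) ⋙ tensorRight ((a s.1)ᘁ)
  additive s := inferInstance
  unit A s := cupRight A.X (a s.1) ((a s.1)ᘁ) ≫ ((A.γ (σ.orbit j)).β (a s.1)).hom ▷ (a s.1)ᘁ ≫
    (a s.1 ◁ P.unit A s.2) ▷ (a s.1)ᘁ
  counit A s := ((∑ i, d i * d i)⁻¹ * d s.1) • ((a s.1 ◁ P.counit A s.2) ▷ (a s.1)ᘁ ≫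
    ((A.γ (σ.orbit j)).β (a s.1)).inv ▷ (a s.1)ᘁ ≫ R.capRight A.X (a s.1) ((a s.1)ᘁ))
  unit_naturality p s := by
    have h := P.unit_naturality p s.2
    have hβ := β_comp_whiskerLeft p (σ.orbit j) (a s.1)
    have hm : (P.functor s.2 ⋙ tensorLeft (a s.1) ⋙ tensorRight ((a s.1)ᘁ)).map p.f =
        (a s.1 ◁ (P.functor s.2).map p.f) ▷ (a s.1)ᘁ := rfl
    rw [hm, Category.assoc, Category.assoc, ← comp_whiskerRight (a s.1 ◁ _),
      ← MonoidalCategory.whiskerLeft_comp, h, MonoidalCategory.whiskerLeft_comp,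
      comp_whiskerRight, ← comp_whiskerRight_assoc (Iso.hom _), hβ, comp_whiskerRight,
      Category.assoc, reassoc_of% cupRight_naturality p.f]
  counit_naturality p s := by
    have h := P.counit_naturality p s.2
    have hβ := whiskerLeft_comp_β_inv p (σ.orbit j) (a s.1)
    have hm : (P.functor s.2 ⋙ tensorLeft (a s.1) ⋙ tensorRight ((a s.1)ᘁ)).map p.f =
        (a s.1 ◁ (P.functor s.2).map p.f) ▷ (a s.1)ᘁ := rfl
    rw [hm, Linear.comp_smul, Linear.smul_comp, ← comp_whiskerRight_assoc,
      ← MonoidalCategory.whiskerLeft_comp, h, MonoidalCategory.whiskerLeft_comp,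
      comp_whiskerRight, Category.assoc, ← comp_whiskerRight_assoc (_ ◁ p.f), hβ,
      comp_whiskerRight]
    simp only [Category.assoc]
    rw [R.capRight_naturality]
  sum_unit_counit A := by
    have h := P.sum_conj (R := R) a (fun i => (∑ i, d i * d i)⁻¹ * d i) (σ.orbit j) (𝟙 A.X)
    refine (Finset.sum_congr rfl fun s _ => ?_).trans (h.trans ?_)
    · rw [CategoryTheory.Functor.map_id, MonoidalCategory.whiskerLeft_id, id_whiskerRight,
        Category.id_comp]
    · simp only [P.average_id, HalfBraiding.ptr_conj_id _ (hd _), smul_smul, ← Finset.sum_smul,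
        mul_assoc, ← Finset.mul_sum, inv_mul_cancel₀ hd0, one_smul]
  isCompatible {A B} f l hl := by
    have hs := P.sum_conj (R := R) a (fun i => (∑ i, d i * d i)⁻¹ * d i) (σ.orbit j) f
    refine Eq.mp (congrArg _ hs.symm) ?_
    rcases Nat.lt_succ_iff_lt_or_eq.1 hl with hl | hl
    -- For an earlier orbit, compatibility was achieved by `P` and survives each new loop
    -- separately. For the orbit of `j` itself, the whole weighted sum is needed.
    · refine .sum fun i => .smul ?_ _
      refine HalfBraiding.isCompatible_ptr_conj (P.isCompatible f l hl) ?_ _ _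
      -- No earlier element lies in the orbit of `j`, so `j` is its lower element, and the earlier
      -- orbits have smaller lower elements.
      have hj' : σ.lower j = j := min_eq_left (le_of_not_gt fun hlt =>
        h (σ.1 j) (by rw [← hj]; exact hlt) (σ.orbit_apply j))
      have hlj : σ.lower l < σ.lower j := by
        rw [hj']
        exact lt_of_le_of_lt (min_le_left _ _) (Fin.lt_def.2 (hj ▸ hl))
      rcases comm_or (C := C) (h l hl) hlj with h | h | h
      · exact .inl ⟨h A, h B⟩
      · exact .inr (.inl ⟨h A, h B⟩)
      · exact .inr (.inr ⟨h A, h B⟩)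
    · obtain rfl : l = j := Fin.ext (hl.trans hj.symm)
      simp only [mul_smul, ← Finset.smul_sum]
      exact .smul (HalfBraiding.isCompatible_sum_ptr_conj ha h1 hd _) _

theorem nonempty {N : ℕ} {a : Fin N → C} {d : Fin N → k}
    (ha : IsSimpleBasis k a) (h1 : 𝟙 (𝟙_ C) ≠ 0)
    (hd : ∀ i, R.tr (a i) ((a i)ᘁ) (𝟙 _) = d i • 𝟙 _) (hd0 : ∑ i, d i * d i ≠ 0) (m : ℕ)
    (hm : m ≤ 2 * n) : Nonempty (AveragingOperator C σ m) := by
  induction m with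
  | zero => exact ⟨zero⟩
  | succ m ih =>
    obtain ⟨P⟩ := ih (Nat.le_of_succ_le hm)
    by_cases h : ∃ i : Fin (2 * n), i.1 < m ∧ σ.orbit i = σ.orbit ⟨m, hm⟩
    · obtain ⟨i, hi, h⟩ := h
      exact ⟨P.succOfMem ⟨m, hm⟩ rfl i hi h⟩
    · push Not at h
      exact ⟨P.succ ha h1 hd hd0 ⟨m, hm⟩ rfl h⟩

/-- The average over all orbits as a morphism of `Z_σ(C)`. -/
def averageHom (P : AveragingOperator C σ (2 * n)) {A B : HigherCenter C σ} (f : A.X ⟶ B.X) :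
    A ⟶ B where
  f := P.average f
  comm o := by
    obtain ⟨i, rfl⟩ := Quotient.exists_rep o
    exact P.isCompatible f i i.2

end AveragingOperator

end HigherCenter

/-! ### Retracts and sums in the categorical center of higher genera -/

section Glue

variable {C : Type u} [Category.{v} C]

/-- An additive functor preserves the resolution of the identity. For tensoring functors this
reduces identities between glued half-braidings to the summands. -/
theorem CategoryTheory.Functor.hom_ext_of_sum_eq_id [Preadditive C] {D : Type*} [Category D]
    [Preadditive D] (F : C ⥤ D) [F.Additive] {J : Type*} [Fintype J] {S : J → C} {X : C}
    {ι : ∀ j, S j ⟶ X} {π : ∀ j, X ⟶ S j} (total : ∑ j, π j ≫ ι j = 𝟙 X) {T : D}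
    {f g : F.obj X ⟶ T} (h : ∀ j, F.map (ι j) ≫ f = F.map (ι j) ≫ g) : f = g := by
  rw [← Category.id_comp f, ← Category.id_comp g, ← F.map_id, ← total, F.map_sum,
    Preadditive.sum_comp, Preadditive.sum_comp]
  simp [h]

variable [MonoidalCategory C]

/-- A morphism compatible with two pairs of crossings intertwines the two sides of the exchange
relation. -/
theorem ExchangeRelation.comp_eq_comp [BraidedCategory C] {X Y Z₁ Z₂ : C} {a : Z₁ ⊗ X ⟶ X ⊗ Z₁}
    {b : Z₂ ⊗ X ⟶ X ⊗ Z₂} {a' : Z₁ ⊗ Y ⟶ Y ⊗ Z₁} {b' : Z₂ ⊗ Y ⟶ Y ⊗ Z₂} {d : Z₁ ⊗ Z₂ ⟶ Z₂ ⊗ Z₁}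
    (h : ExchangeRelation a b d) {f : X ⟶ Y} (ha : Z₁ ◁ f ≫ a' = a ≫ f ▷ Z₁)
    (hb : Z₂ ◁ f ≫ b' = b ≫ f ▷ Z₂) :
    Z₂ ◁ Z₁ ◁ f ≫ Z₂ ◁ a' ≫ (α_ Z₂ Y Z₁).inv ≫ b' ▷ Z₁ =
      Z₂ ◁ Z₁ ◁ f ≫ (α_ Z₂ Z₁ Y).inv ≫ (β_ Z₁ Z₂).inv ▷ Y ≫ (α_ Z₁ Z₂ Y).hom ≫ Z₁ ◁ b' ≫
        (α_ Z₁ Y Z₂).inv ≫ a' ▷ Z₂ ≫ (α_ Y Z₁ Z₂).hom ≫ Y ◁ d ≫ (α_ Y Z₂ Z₁).inv := by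
  calc
    _ = Z₂ ◁ (Z₁ ◁ f ≫ a') ≫ (α_ Z₂ Y Z₁).inv ≫ b' ▷ Z₁ := by simp
    _ = Z₂ ◁ a ≫ (α_ Z₂ X Z₁).inv ≫ (Z₂ ◁ f ≫ b') ▷ Z₁ := by rw [ha]; simp
    _ = (Z₂ ◁ a ≫ (α_ Z₂ X Z₁).inv ≫ b ▷ Z₁) ≫ f ▷ Z₂ ▷ Z₁ := by rw [hb]; simp
    _ = (α_ Z₂ Z₁ X).inv ≫ (β_ Z₁ Z₂).inv ▷ X ≫ (α_ Z₁ Z₂ X).hom ≫ Z₁ ◁ b ≫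
        (α_ Z₁ X Z₂).inv ≫ a ▷ Z₂ ≫ (α_ X Z₁ Z₂).hom ≫ (X ◁ d ≫ f ▷ (Z₂ ⊗ Z₁)) ≫
          (α_ Y Z₂ Z₁).inv := by
      rw [h]; simp
    _ = (α_ Z₂ Z₁ X).inv ≫ (β_ Z₁ Z₂).inv ▷ X ≫ (α_ Z₁ Z₂ X).hom ≫ Z₁ ◁ b ≫
        (α_ Z₁ X Z₂).inv ≫ (a ≫ f ▷ Z₁) ▷ Z₂ ≫ (α_ Y Z₁ Z₂).hom ≫ Y ◁ d ≫
          (α_ Y Z₂ Z₁).inv := by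
      rw [whisker_exchange]; simp
    _ = (α_ Z₂ Z₁ X).inv ≫ (β_ Z₁ Z₂).inv ▷ X ≫ (α_ Z₁ Z₂ X).hom ≫ Z₁ ◁ (b ≫ f ▷ Z₂) ≫
        (α_ Z₁ Y Z₂).inv ≫ a' ▷ Z₂ ≫ (α_ Y Z₁ Z₂).hom ≫ Y ◁ d ≫ (α_ Y Z₂ Z₁).inv := by
      rw [← ha]; simp
    _ = (α_ Z₂ Z₁ X).inv ≫ ((β_ Z₁ Z₂).inv ▷ X ≫ (Z₁ ⊗ Z₂) ◁ f) ≫ (α_ Z₁ Z₂ Y).hom ≫ Z₁ ◁ b' ≫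
        (α_ Z₁ Y Z₂).inv ≫ a' ▷ Z₂ ≫ (α_ Y Z₁ Z₂).hom ≫ Y ◁ d ≫ (α_ Y Z₂ Z₁).inv := by
      rw [← hb]; simp
    _ = _ := by
      rw [← whisker_exchange]; simp

variable [Preadditive C] [MonoidalPreadditive C] {J : Type*} [Fintype J] {S : J → C} {X : C}

namespace CategoryTheory.HalfBraiding

section

variable (γ : ∀ j, HalfBraiding (S j)) (ι : ∀ j, S j ⟶ X) (π : ∀ j, X ⟶ S j)

/-- The sum of the half-braidings of the summands of `X`. -/
def glueHom (Z : C) : X ⊗ Z ⟶ Z ⊗ X := ∑ j, π j ▷ Z ≫ ((γ j).β Z).hom ≫ Z ◁ ι j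

/-- The sum of the inverse half-braidings of the summands of `X`. -/
def glueInv (Z : C) : Z ⊗ X ⟶ X ⊗ Z := ∑ j, Z ◁ π j ≫ ((γ j).β Z).inv ≫ ι j ▷ Z

variable {γ ι π} (total : ∑ j, π j ≫ ι j = 𝟙 X)
  (h : ∀ j j', IsCompatible (γ j) (γ j') (ι j ≫ π j'))

include total h

/-- By `h`, `ι j ≫ π j'` passes through the half-braidings, after which the sum over `j'` collapses
by `total`. The `ι j ≫ π j'` need not be Kronecker deltas, so retracts are covered as well as direct
sums. -/
theorem ι_glueHom (j : J) (Z : C) :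
    ι j ▷ Z ≫ glueHom γ ι π Z = ((γ j).β Z).hom ≫ Z ◁ ι j := by
  have h' := fun j' => isCompatible_iff.1 (h j j') Z
  simp only [comp_whiskerRight, Category.assoc] at h'
  simp only [glueHom, Preadditive.comp_sum, reassoc_of% h']
  simp only [← MonoidalCategory.whiskerLeft_comp, ← Preadditive.comp_sum, ← whiskerLeft_sum,
    Category.assoc,
    total, Category.comp_id]

theorem ι_glueInv (j : J) (Z : C) :
    Z ◁ ι j ≫ glueInv γ ι π Z = ((γ j).β Z).inv ≫ ι j ▷ Z := by
  have h' := fun j' => h j j' Z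
  simp only [cross, MonoidalCategory.whiskerLeft_comp, Category.assoc] at h'
  simp only [glueInv, Preadditive.comp_sum, reassoc_of% h']
  simp only [← comp_whiskerRight, ← Preadditive.comp_sum, ← sum_whiskerRight, Category.assoc,
    total, Category.comp_id]

/-- The half-braiding on `X` glued from half-braidings on its summands. -/
def glue : HalfBraiding X where
  β Z :=
    { hom := glueHom γ ι π Z
      inv := glueInv γ ι π Z
      hom_inv_id := (tensorRight Z).hom_ext_of_sum_eq_id total fun j => by
        simp [reassoc_of% ι_glueHom total h, ι_glueInv total h]
      inv_hom_id := (tensorLeft Z).hom_ext_of_sum_eq_id total fun j => by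
        simp [reassoc_of% ι_glueInv total h, ι_glueHom total h] }
  monoidal U V := (tensorRight (U ⊗ V)).hom_ext_of_sum_eq_id total fun j => by
    have h₁ : U ◁ ι j ▷ V ≫ U ◁ glueHom γ ι π V =
        U ◁ ((γ j).β V).hom ≫ U ◁ V ◁ ι j := by
      rw [← MonoidalCategory.whiskerLeft_comp, ι_glueHom total h,
        MonoidalCategory.whiskerLeft_comp]
    have h₂ : ι j ▷ U ▷ V ≫ glueHom γ ι π U ▷ V =
        ((γ j).β U).hom ▷ V ≫ (U ◁ ι j) ▷ V := by
      rw [← comp_whiskerRight, ι_glueHom total h, comp_whiskerRight]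
    change ι j ▷ _ ≫ _ = ι j ▷ _ ≫ _
    rw [ι_glueHom total h, (γ j).monoidal, associator_inv_naturality_left_assoc,
      reassoc_of% h₂, associator_naturality_middle_assoc, reassoc_of% h₁]
    simp
  naturality {U V} f := (tensorRight U).hom_ext_of_sum_eq_id total fun j => by
    change ι j ▷ _ ≫ _ = ι j ▷ _ ≫ _
    rw [← whisker_exchange_assoc, ι_glueHom total h, (γ j).naturality_assoc,
      reassoc_of% ι_glueHom total h, whisker_exchange]

theorem isCompatible_ι (j : J) : IsCompatible (γ j) (glue total h) (ι j) :=
  fun Z => ι_glueInv total h j Z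

theorem isCompatible_π (j : J) : IsCompatible (glue total h) (γ j) (π j) := fun Z =>
  (tensorLeft Z).hom_ext_of_sum_eq_id total fun j' => by
    have h' := h j' j Z
    change Z ◁ ι j' ≫ _ = Z ◁ ι j' ≫ _
    rw [← MonoidalCategory.whiskerLeft_comp_assoc, h', reassoc_of% isCompatible_ι total h j' Z,
      comp_whiskerRight]

end

variable [BraidedCategory C] {γ δ : ∀ j, HalfBraiding (S j)} {ι : ∀ j, S j ⟶ X}
  {π : ∀ j, X ⟶ S j} (total : ∑ j, π j ≫ ι j = 𝟙 X)
  (hγ : ∀ j j', IsCompatible (γ j) (γ j') (ι j ≫ π j'))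
  (hδ : ∀ j j', IsCompatible (δ j) (δ j') (ι j ≫ π j'))

theorem _root_.ExchangeRelation.glue {Z₁ Z₂ : C} {a : ∀ j, Z₁ ⊗ S j ⟶ S j ⊗ Z₁}
    {b : ∀ j, Z₂ ⊗ S j ⟶ S j ⊗ Z₂} {a' : Z₁ ⊗ X ⟶ X ⊗ Z₁} {b' : Z₂ ⊗ X ⟶ X ⊗ Z₂}
    {d : Z₁ ⊗ Z₂ ⟶ Z₂ ⊗ Z₁} (total : ∑ j, π j ≫ ι j = 𝟙 X)
    (h : ∀ j, ExchangeRelation (a j) (b j) d)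
    (ha : ∀ j, Z₁ ◁ ι j ≫ a' = a j ≫ ι j ▷ Z₁) (hb : ∀ j, Z₂ ◁ ι j ≫ b' = b j ≫ ι j ▷ Z₂) :
    ExchangeRelation a' b' d :=
  (tensorLeft Z₁ ⋙ tensorLeft Z₂).hom_ext_of_sum_eq_id total fun j =>
    (h j).comp_eq_comp (ha j) (hb j)

theorem _root_.Comm1.glue (h : ∀ j, Comm1 (γ j) (δ j)) : Comm1 (glue total hγ) (glue total hδ) :=
  fun Z₁ Z₂ => .glue total (fun j => h j Z₁ Z₂)
    (fun j => by rw [reassoc_of% isCompatible_ι total hγ j Z₁]; simp)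
    (fun j => isCompatible_ι total hδ j Z₂)

theorem _root_.Comm2.glue (h : ∀ j, Comm2 (γ j) (δ j)) : Comm2 (glue total hγ) (glue total hδ) :=
  fun Z₁ Z₂ => .glue total (fun j => h j Z₁ Z₂) (fun j => isCompatible_ι total hγ j Z₁)
    (fun j => isCompatible_ι total hδ j Z₂)

theorem _root_.Comm3.glue (h : ∀ j, Comm3 (γ j) (δ j)) : Comm3 (glue total hγ) (glue total hδ) :=
  fun Z₁ Z₂ => .glue total (fun j => h j Z₁ Z₂) (fun j => isCompatible_ι total hγ j Z₁)
    (fun j => isCompatible_ι total hδ j Z₂)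

end CategoryTheory.HalfBraiding

end Glue

/-! ### Split idempotents and finite products of `σ`-pairs. -/

namespace HigherCenter

variable {C : Type u} [Category.{v} C] [MonoidalCategory C] [BraidedCategory C] {n : ℕ}
  {σ : AdmissibleGluing n} [Preadditive C] [MonoidalPreadditive C]

section

variable {J : Type*} [Fintype J] {A : J → HigherCenter C σ} {X : C} {ι : ∀ j, (A j).X ⟶ X}
  {π : ∀ j, X ⟶ (A j).X} (total : ∑ j, π j ≫ ι j = 𝟙 X)
  (h : ∀ o j j', HalfBraiding.IsCompatible ((A j).γ o) ((A j').γ o) (ι j ≫ π j'))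

/-- The `σ`-pair glued from `σ`-pairs on the summands of an object. -/
def glue : HigherCenter C σ where
  X := X
  γ o := HalfBraiding.glue total (h o)
  comm1 i j h₁ h₂ h₃ := .glue _ _ _ fun l => (A l).comm1 i j h₁ h₂ h₃
  comm2 i j h₁ h₂ h₃ := .glue _ _ _ fun l => (A l).comm2 i j h₁ h₂ h₃
  comm3 i j h₁ h₂ h₃ := .glue _ _ _ fun l => (A l).comm3 i j h₁ h₂ h₃

/-- The inclusion of a summand. -/
def glueι (j : J) : A j ⟶ glue total h where
  f := ι j
  comm o := HalfBraiding.isCompatible_ι total (h o) j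

/-- The projection to a summand. -/
def glueπ (j : J) : glue total h ⟶ A j where
  f := π j
  comm o := HalfBraiding.isCompatible_π total (h o) j

end

@[simp]
theorem sum_f {J : Type*} (s : Finset J) {A B : HigherCenter C σ} (p : J → (A ⟶ B)) :
    (∑ j ∈ s, p j).f = ∑ j ∈ s, (p j).f :=
  map_sum (AddMonoidHom.mk' (fun p : A ⟶ B => p.f) add_f) p s

instance [IsIdempotentComplete C] : IsIdempotentComplete (HigherCenter C σ) where
  idempotents_split A e he := by
    obtain ⟨Y, i, p, hip, hpi⟩ := IsIdempotentComplete.idempotents_split A.X e.f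
      (congrArg Hom.f he)
    have total : ∑ _ : Unit, i ≫ p = 𝟙 Y := by simp [hip]
    have h : ∀ (o : σ.Orbit) (_ _ : Unit), HalfBraiding.IsCompatible (A.γ o) (A.γ o) (p ≫ i) :=
      fun o _ _ => by rw [hpi]; exact e.comm o
    exact ⟨glue (A := fun _ => A) total h, glueπ (A := fun _ => A) total h (),
      glueι (A := fun _ => A) total h (), hom_ext _ _ hip, hom_ext _ _ hpi⟩

instance [HasFiniteProducts C] : HasFiniteProducts (HigherCenter C σ) := by
  have := HasFiniteBiproducts.of_hasFiniteProducts (C := C)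
  have : HasFiniteBiproducts (HigherCenter C σ) := ⟨fun m => ⟨fun A => by
    have total := biproduct.total (f := fun j => (A j).X)
    -- Each `ι j ≫ π j'` underlies a morphism of `σ`-pairs, an `eqToHom` or zero, which makes it
    -- compatible.
    have hι : ∀ j j', biproduct.ι (fun j => (A j).X) j ≫ biproduct.π (fun j => (A j).X) j' =
        if h : j = j' then (eqToHom (congrArg A h) : A j ⟶ A j').f else 0 := fun j j' => by
      rw [biproduct.ι_π]
      split
      · next h => subst h; rfl
      · rfl
    have h : ∀ o j j', HalfBraiding.IsCompatible ((A j).γ o) ((A j').γ o)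
        (biproduct.ι (fun j => (A j).X) j ≫ biproduct.π (fun j => (A j).X) j') := fun o j j' => by
      rw [hι]
      split
      · next e => exact (eqToHom (congrArg A e) : A j ⟶ A j').comm o
      · exact (0 : A j ⟶ A j').comm o
    exact HasBiproduct.mk
      { bicone :=
          { pt := glue total h
            π := glueπ total h
            ι := glueι total h
            ι_π := fun j j' => hom_ext _ _ <| (hι j j').trans <| by split <;> rfl }
        isBilimit := isBilimitOfTotal _ (hom_ext _ _ (by
          rw [sum_f]; exact total)) }⟩⟩
  infer_instance

end HigherCenter

/-! ### The categorical center of higher genera is finite semisimple -/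

theorem linearIndependent_of_forall_map_eq_zero {k V I : Type*} {W : I → Type*} [Field k]
    [AddCommGroup V] [Module k V] [∀ i, AddCommGroup (W i)] [∀ i, Module k (W i)] {v : I → V}
    (T : ∀ i, V →ₗ[k] W i) (h : ∀ i j, j ≠ i → T i (v j) = 0) (h' : ∀ i, T i (v i) ≠ 0) :
    LinearIndependent k v := by
  rw [linearIndependent_iff']
  intro s c hc i hi
  have := congrArg (T i) hc
  rw [map_sum, Finset.sum_eq_single_of_mem i hi fun j _ hj => by rw [map_smul, h i j hj, smul_zero],
    map_smul, map_zero] at this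
  exact (smul_eq_zero.1 this).resolve_right (h' i)

namespace HigherCenter

variable {C : Type u} [Category.{v} C] [MonoidalCategory C] [BraidedCategory C] {n : ℕ}
  {σ : AdmissibleGluing n} [Preadditive C]

namespace AveragingOperator

theorem average_zero {m : ℕ} (P : AveragingOperator C σ m) {A B : HigherCenter C σ} :
    P.average (0 : A.X ⟶ B.X) = 0 := by
  simp [average]

theorem average_sum {m : ℕ} (P : AveragingOperator C σ m) {A B : HigherCenter C σ} {J : Type*}
    (s : Finset J) (f : J → (A.X ⟶ B.X)) : P.average (∑ j ∈ s, f j) = ∑ j ∈ s, P.average (f j) := by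
  simp only [average, Functor.map_sum, Preadditive.sum_comp, Preadditive.comp_sum]
  exact Finset.sum_comm

variable (P : AveragingOperator C σ (2 * n))

-- If `g` is a generalized inverse of `p` in `C`, then `p ≫ P(g) ≫ p = P(p ≫ g ≫ p) = P(p) = p ≫
-- P(𝟙) = p`.
include P in
theorem isRegularCategory (hC : IsRegularCategory C) : IsRegularCategory (HigherCenter C σ) :=
  fun {A B} p => by
    obtain ⟨g, hg⟩ := hC p.f
    refine ⟨P.averageHom g, hom_ext _ _ ?_⟩
    change p.f ≫ P.average g ≫ p.f = p.f
    rw [← P.average_comp, ← P.comp_average, hg]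
    simpa [P.average_id] using P.comp_average p (𝟙 B.X)

variable [MonoidalPreadditive C] {k : Type w} [Field k] [Linear k C]

include P in
theorem finite_simples [HasKernels (HigherCenter C σ)]
    (hfd : ∀ X Y : C, FiniteDimensional k (X ⟶ Y)) {I : Type*} [Fintype I] {a : I → C}
    (ha : IsSimpleBasis k a) :
    {c : Quotient (isIsomorphicSetoid (HigherCenter C σ)) |
      ∃ A : HigherCenter C σ, Simple A ∧ Quotient.mk (isIsomorphicSetoid _) A = c}.Finite := by
  have hi : ∀ i, {c : Quotient (isIsomorphicSetoid (HigherCenter C σ)) |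
      ∃ A : HigherCenter C σ, Simple A ∧ Quotient.mk (isIsomorphicSetoid _) A = c ∧
        ∃ (g : A.X ⟶ a i) (h : a i ⟶ A.X), P.average (g ≫ h) ≠ 0}.Finite := fun i => by
    rw [← Set.finite_coe_iff]
    choose A hA hAc g h hgh using fun c : {c : Quotient (isIsomorphicSetoid (HigherCenter C σ)) |
      ∃ A : HigherCenter C σ, Simple A ∧ Quotient.mk (isIsomorphicSetoid _) A = c ∧
        ∃ (g : A.X ⟶ a i) (h : a i ⟶ A.X), P.average (g ≫ h) ≠ 0} => c.2
    have key : ∀ c c', (∑ s, (h c' ≫ P.unit (A c') s ≫ (P.functor s).map (g c')) ≫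
        (P.functor s).map (h c) ≫ P.counit (A c) s) = h c' ≫ P.average (g c' ≫ h c) :=
      fun c c' => by simp [average, Preadditive.comp_sum]
    let T : ∀ c, (∀ s, a i ⟶ (P.functor s).obj (a i)) →ₗ[k] (a i ⟶ (A c).X) := fun c =>
      { toFun := fun ψ => ∑ s, ψ s ≫ (P.functor s).map (h c) ≫ P.counit (A c) s
        map_add' := fun ψ φ => by simp [Finset.sum_add_distrib]
        map_smul' := fun t ψ => by simp [Finset.smul_sum] }
    -- `T c` sends the vector of `c'` to `h c'` followed by a morphism of `Z_σ(C)` between simples.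
    -- By Schur's lemma this morphism is zero if `c ≠ c'`. If `c = c'`, it is invertible, and `h c`
    -- is nonzero.
    refine (linearIndependent_of_forall_map_eq_zero (k := k)
      (v := fun c s => h c ≫ P.unit (A c) s ≫ (P.functor s).map (g c)) T
      (fun c c' hc => (key c c').trans ?_) fun c => ?_).finite
    · by_contra hne
      have : P.averageHom (g c' ≫ h c) ≠ 0 := fun h0 => hne (by
        rw [show P.average (g c' ≫ h c) = 0 from congrArg Hom.f h0, comp_zero])
      have := hA c
      have := hA c'
      have := isIso_of_hom_simple ‹P.averageHom (g c' ≫ h c) ≠ 0›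
      exact hc (Subtype.ext ((hAc c').symm.trans
        ((Quotient.sound (s := isIsomorphicSetoid _)
          ⟨asIso (P.averageHom (g c' ≫ h c))⟩).trans (hAc c))))
    · intro h0
      have h0 : h c ≫ P.average (g c ≫ h c) = 0 := (key c c).symm.trans h0
      have hne : P.averageHom (g c ≫ h c) ≠ 0 := fun h0 => hgh c (congrArg Hom.f h0)
      have := hA c
      have := isIso_of_hom_simple hne
      have hinv : P.average (g c ≫ h c) ≫ (inv (P.averageHom (g c ≫ h c))).f = 𝟙 _ :=
        congrArg Hom.f (IsIso.hom_inv_id (P.averageHom (g c ≫ h c)))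
      refine hgh c ?_
      rw [show h c = 0 by
        rw [← Category.comp_id (h c), ← hinv, reassoc_of% h0, zero_comp], comp_zero, average_zero]
  refine (Set.finite_iUnion hi).subset ?_
  rintro c ⟨A, hA, hAc⟩
  obtain ⟨d⟩ := ha.exists_isotypicDecomposition A.X
  by_contra hc
  refine id_nonzero A (hom_ext _ _ ?_)
  -- Every simple is detected by some `a i`: otherwise all terms of the averaged decomposition of
  -- its identity would vanish.
  rw [id_f, ← P.average_id, ← d.total, average_sum]
  refine Finset.sum_eq_zero fun i _ => ?_
  rw [average_sum]
  refine Finset.sum_eq_zero fun r _ => ?_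
  by_contra hne
  exact hc (Set.mem_iUnion.2 ⟨i, A, hA, hAc, _, _, hne⟩)

end AveragingOperator

end HigherCenter

theorem mainTheorem2 (k : Type w) [Field k] [IsAlgClosed k] [CharZero k]
    (C : Type u) [Category.{v} C] [Preadditive C] [Linear k C]
    [MonoidalCategory C] [MonoidalPreadditive C] [MonoidalLinear k C]
    [BraidedCategory C] [RigidCategory C] [PremodularCategory k C]
    (n : ℕ) (σ : AdmissibleGluing n) :
    IsFiniteSemisimpleAbelian (HigherCenter C σ) k := by
  have hC : IsFiniteSemisimpleAbelian C k := PremodularCategory.isFiniteSemisimpleAbelian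
  obtain ⟨e⟩ := PremodularCategory.end_unit (k := k) (C := C)
  have h1 : 𝟙 (𝟙_ C) ≠ 0 := fun h => one_ne_zero (α := k) (by
    rw [← map_one e, show (1 : End (𝟙_ C)) = 0 from h, map_zero])
  have hk : ∀ f : 𝟙_ C ⟶ 𝟙_ C, ∃ c : k, f = c • 𝟙 _ := fun f =>
    ⟨e f, e.injective (by
      change e f = e (e f • (1 : End (𝟙_ C)))
      rw [map_smul, map_one, smul_eq_mul, mul_one])⟩
  obtain ⟨N, a, ha⟩ := hC.exists_isSimpleBasis k
  let R : RibbonStructure C := PremodularCategory.ribbon k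
  -- The traces are scalars because the unit has only scalar endomorphisms.
  choose d hd using fun i => hk (R.tr (a i) ((a i)ᘁ) (𝟙 _))
  obtain ⟨P⟩ := HigherCenter.AveragingOperator.nonempty (σ := σ) ha h1 hd
    (sum_dim_sq_ne_zero ha h1 hk hd) _ le_rfl
  let := hC.isAbelian.abelian
  have := hC.isAbelian.hasFiniteProducts
  have hreg : IsRegularCategory (HigherCenter C σ) := P.isRegularCategory
    (isRegularCategory_of_isSemisimpleObject hC.isAbelian hC.isSemisimple)
  have := hreg.hasKernels
  refine hreg.isFiniteSemisimpleAbelian k (fun A B => ?_)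
    (P.finite_simples hC.finiteDimensional_hom ha)
  have := hC.finiteDimensional_hom A.X B.X
  exact FiniteDimensional.of_injective
    ({ toFun := fun p => p.f, map_add' := HigherCenter.add_f, map_smul' := HigherCenter.smul_f } :
      (A ⟶ B) →ₗ[k] (A.X ⟶ B.X)) HigherCenter.hom_ext
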